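/- Let $D\subseteq\mathbb C$ be a domain (a non-empty connected open set), let $\mathbb C_\infty=\mathbb C\cup\{\infty\}$, and let $\mathcal M(D)$ be the class of all meromorphic functions on $D$, regarded as functions $D\to\mathbb C_\infty$ with the value $\infty$ at the poles. For $f\in\mathcal M(D)$ and $a\in\mathbb C_\infty$ put $\bar E(f,a)=\{z\in D: f(z)=a\}$; we say that $f$ and $g$ share $a$ partially in $D$ if $\bar E(f,a)\subseteq\bar E(g,a)$. Spherical locally uniform convergence in $D$ means locally uniform convergence in $D$ with respect to the chordal (equivalently, spherical) metric on $\mathbb C_\infty$. A family $\mathcal F\subseteq\mathcal M(D)$ is normal in $D$ if every sequence in $\mathcal F$ has a subsequence that converges spherically locally uniformly in $D$ to some function $D\to\mathbb C_\infty$ (the constant function $\infty$ is allowed as a limit). A limit function of $\mathcal G\subseteq\mathcal M(D)$ is a function $g:D\to\mathbb C_\infty$ to which some sequence in $\mathcal G$ (whose terms need not be distinct) converges spherically locally uniformly in $D$. **Theorem.** Let $\mathcal F,\mathcal G\subseteq\mathcal M(D)$ and let $a_1,a_2,a_3\in\mathbb C_\infty$ be three distinct values. Suppose that $\mathcal G$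 is normal in $D$ and that all limit functions of $\mathcal G$ are non-constant. If for each $f\in\mathcal F$ there exists $g\in\mathcal G$ such that $f$ and $g$ share $a_j$ partially in $D$ for each $j=1,2,3$, then $\mathcal F$ is normal in $D$. -/

import Mathlib

open Filter Topology

/-- `𝓜(D)`. The extended complex plane is `OnePoint ℂ`. An element is a function with values in
`OnePoint ℂ` (its values outside `D` play no role) which on `D` is given by a function `h`
meromorphic on `D` in Mathlib's sense: at each point of `D` the value is the limit of `h` in
`OnePoint ℂ`, so it is `∞` at the poles and the finite limit at all other points. -/
def meromorphicFunctions (D : Set ℂ) : Set (ℂ → OnePoint ℂ) :=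
  {f | ∃ h : ℂ → ℂ, MeromorphicOn h D ∧
    ∀ z ∈ D, Tendsto (fun w => (h w : OnePoint ℂ)) (𝓝[≠] z) (𝓝 (f z))}

/-- The chordal distance on the extended complex plane; it is uniformly equivalent to the geodesic
distance of the Riemann sphere. -/
noncomputable def chordalDist : OnePoint ℂ → OnePoint ℂ → ℝ
  | none, none => 0
  | none, some w => 2 / √(1 + ‖w‖ ^ 2)
  | some z, none => 2 / √(1 + ‖z‖ ^ 2)
  | some z, some w => 2 * ‖z - w‖ / (√(1 + ‖z‖ ^ 2) * √(1 + ‖w‖ ^ 2))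

/-- `s n` converges to `g` spherically locally uniformly in `D`. -/
def ConvergesSpherically (D : Set ℂ) (s : ℕ → ℂ → OnePoint ℂ) (g : ℂ → OnePoint ℂ) : Prop :=
  ∀ z₀ ∈ D, ∃ U ∈ 𝓝 z₀, ∀ ε : ℝ, 0 < ε → ∀ᶠ n in atTop, ∀ z ∈ U ∩ D, chordalDist (s n z) (g z) < ε

/-- Every sequence in the family has a subsequence converging spherically locally uniformly. -/
def IsNormalFamily (D : Set ℂ) (F : Set (ℂ → OnePoint ℂ)) : Prop :=
  ∀ s : ℕ → ℂ → OnePoint ℂ, (∀ n, s n ∈ F) →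
    ∃ φ : ℕ → ℕ, StrictMono φ ∧ ∃ g : ℂ → OnePoint ℂ, ConvergesSpherically D (s ∘ φ) g

/-- `g` is the spherical locally uniform limit in `D` of some sequence in the family. -/
def IsLimitFunction (D : Set ℂ) (G : Set (ℂ → OnePoint ℂ)) (g : ℂ → OnePoint ℂ) : Prop :=
  ∃ s : ℕ → ℂ → OnePoint ℂ, (∀ n, s n ∈ G) ∧ ConvergesSpherically D s g

/-- `Ē(f, a)`: the set of `a`-points of `f` in `D`, ignoring multiplicity. -/
def aPoints (D : Set ℂ) (f : ℂ → OnePoint ℂ) (a : OnePoint ℂ) : Set ℂ :=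
  {z ∈ D | f z = a}

/-- `f` and `g` share the value `a` partially in `D`: every `a`-point of `f` is one of `g`. -/
def SharePartially (D : Set ℂ) (f g : ℂ → OnePoint ℂ) (a : OnePoint ℂ) : Prop :=
  aPoints D f a ⊆ aPoints D g a

/-!
Let `s n` be a sequence in `F`. The sequence `t n` in `G` of its partners has a subsequence
converging to a nonconstant map `g`, holomorphic into the Riemann sphere; pass to it. Where `g`
avoids the three values, so do `t n` and hence `s n` locally, for large `n`, and Montel's theorem
for three omitted values (`asymptoticallyEquicontinuousAt_of_omits_three`) makes the `s n`
equicontinuous there. By Arzelà–Ascoli a subsequence converges locally uniformly off the set of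
points where `g` takes one of the three values. This set is discrete in `D`, as `g` is not
constant, and near any of its points the `s n` still omit the two values that `g` does not take
there. Moving these two values to `0` and `∞`, the `s n` become zero-free and pole-free on a disc
whose boundary circle lies in the region of convergence. By Hurwitz's theorem the limit on the
circle is finite or identically `∞`; accordingly the maximum principle bounds the `s n` or their
reciprocals on the disc, so that equicontinuity holds at the centre too
(`asymptoticallyEquicontinuousAt_of_omits_two`). Arzelà–Ascoli on all of `D` finishes the proof.

Montel's theorem is reduced by a Möbius transformation to holomorphic functions `f` omitting `0`
and `1`. For these Ahlfors' method gives a bound on the spherical derivative: `ℂ \ {0, 1}` carries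
an explicit conformal metric, with density
`((1 + |w| ^ (1/3)) (1 + |w - 1| ^ (1/3))) ^ (1/2) / (|w| |w - 1|) ^ (5/6)`, whose curvature is at
most a negative constant and which dominates the spherical metric up to a constant. At a point of
the unit disc where the ratio of the pulled back metric to the hyperbolic metric is maximal, the
Laplacian of its logarithm is nonpositive, and this bounds the ratio (`ahlfors_lemma`).

Convergence is handled through the filters `atTop ×ˢ 𝓝 z`, that is as continuous convergence,
which depends only on the topology of `OnePoint ℂ` and so is visibly invariant under
homeomorphisms of the sphere.
-/

/-! ### Second derivatives along lines -/

/-- `HasSecondDeriv l d₁ d₂`: near `0` the function `l` is differentiable, with derivative `d₁` at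
`0`, and the derivative is differentiable at `0`, with derivative `d₂`. -/
def HasSecondDeriv (l : ℝ → ℝ) (d₁ d₂ : ℝ) : Prop :=
  ∃ l' : ℝ → ℝ, (∀ᶠ t in 𝓝 0, HasDerivAt l (l' t) t) ∧ l' 0 = d₁ ∧ HasDerivAt l' d₂ 0

theorem HasSecondDeriv.add {l m : ℝ → ℝ} {a b c d : ℝ} (hl : HasSecondDeriv l a b)
    (hm : HasSecondDeriv m c d) : HasSecondDeriv (fun t => l t + m t) (a + c) (b + d) := by
  obtain ⟨l', h1, h2, h3⟩ := hl
  obtain ⟨m', k1, k2, k3⟩ := hm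
  refine ⟨fun t => l' t + m' t, ?_, by simp [h2, k2], h3.add k3⟩
  filter_upwards [h1, k1] with t ht kt using ht.add kt

theorem HasSecondDeriv.comp {l B B' : ℝ → ℝ} {d₁ d₂ B₂ : ℝ} (hl : HasSecondDeriv l d₁ d₂)
    (hB : ∀ᶠ x in 𝓝 (l 0), HasDerivAt B (B' x) x) (hB' : HasDerivAt B' B₂ (l 0)) :
    HasSecondDeriv (fun t => B (l t)) (B' (l 0) * d₁) (B₂ * d₁ ^ 2 + B' (l 0) * d₂) := by
  obtain ⟨l', h1, h2, h3⟩ := hl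
  have h0 := h1.self_of_nhds
  refine ⟨fun t => B' (l t) * l' t, ?_, by simp [h2], ?_⟩
  · filter_upwards [h1, h0.continuousAt.eventually hB] with t ht kt using kt.comp t ht
  · refine ((hB'.comp (0 : ℝ) h0).mul h3).congr_deriv ?_
    simp only [Function.comp, h2]; ring

theorem HasSecondDeriv.nonpos_of_isLocalMax {l : ℝ → ℝ} {d₁ d₂ : ℝ} (hl : HasSecondDeriv l d₁ d₂)
    (hm : IsLocalMax l 0) : d₂ ≤ 0 := by
  obtain ⟨l', h1, h2, h3⟩ := hl
  by_contra! hd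
  have e1 : deriv l =ᶠ[𝓝 0] l' := h1.mono fun t ht => ht.deriv
  have e2 : deriv (deriv l) 0 = d₂ := by rw [e1.deriv_eq, h3.deriv]
  have hmin := isLocalMin_of_deriv_deriv_pos (f := l) (x₀ := 0) (by rw [e2]; exact hd)
    hm.deriv_eq_zero h1.self_of_nhds.continuousAt
  -- A local maximum that is also a local minimum makes `l` locally constant.
  have hc : l =ᶠ[𝓝 0] fun _ => l 0 := by
    filter_upwards [hm, hmin] with t a b using le_antisymm a b
  have e3 : deriv l =ᶠ[𝓝 0] fun _ => 0 := by
    filter_upwards [hc.eventuallyEq_nhds] with t ht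
    rw [ht.deriv_eq]; simp
  rw [e3.deriv_eq] at e2
  simp at e2
  linarith

/-- The logarithm of the modulus of a zero-free holomorphic function along a line; the second
derivatives in the directions `1` and `I` cancel, as it is harmonic. -/
theorem hasSecondDeriv_log_norm {k : ℂ → ℂ} {z : ℂ} (hk : AnalyticAt ℂ k z) (h0 : k z ≠ 0)
    (e : ℂ) : HasSecondDeriv (fun t : ℝ => Real.log ‖k (z + t * e)‖)
      (e * (deriv k z / k z)).re (e ^ 2 * deriv (fun w => deriv k w / k w) z).re := by
  have hline : ∀ t : ℝ, HasDerivAt (fun t : ℝ => z + t * e) e t := fun t => by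
    simpa using ((Complex.ofRealCLM.hasDerivAt (x := t)).mul_const e).const_add z
  have hl0 : (fun t : ℝ => z + t * e) 0 = z := by simp
  have hcont : Tendsto (fun t : ℝ => z + t * e) (𝓝 0) (𝓝 z) := by
    have := (hline 0).continuousAt.tendsto
    simpa using this
  refine ⟨fun t => (e * (deriv k (z + t * e) / k (z + t * e))).re, ?_, by simp, ?_⟩
  · filter_upwards [hcont.eventually hk.eventually_analyticAt,
      hcont.eventually (hk.continuousAt.eventually_ne h0)] with t ht h0
    have h1 : HasDerivAt (fun t : ℝ => k (z + t * e)) (deriv k (z + t * e) * e) t :=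
      ht.differentiableAt.hasDerivAt.comp_of_eq t (hline t) rfl
    have h2 : HasDerivAt (fun t : ℝ => ‖k (z + t * e)‖ ^ 2)
        (2 * inner ℝ (k (z + t * e)) (deriv k (z + t * e) * e)) t := h1.norm_sq
    have h3 := (h2.log (by positivity)).div_const 2
    have : (fun t : ℝ => Real.log ‖k (z + t * e)‖) =
        fun t : ℝ => Real.log (‖k (z + t * e)‖ ^ 2) / 2 := by
      funext t; rw [Real.log_pow]; push_cast; ring
    rw [this]
    refine h3.congr_deriv ?_
    rw [← Complex.normSq_eq_norm_sq, Complex.inner, mul_div_assoc', Complex.div_re,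
      Complex.normSq_apply]
    have : Complex.normSq (k (z + t * e)) ≠ 0 := by simpa using h0
    rw [Complex.normSq_apply] at this
    simp only [Complex.mul_re, Complex.mul_im, Complex.conj_re, Complex.conj_im]
    field_simp
    ring
  · have hq : AnalyticAt ℂ (fun w => deriv k w / k w) z := hk.deriv.div hk h0
    have h1 : HasDerivAt (fun t : ℝ => deriv k (z + t * e) / k (z + t * e))
        (deriv (fun w => deriv k w / k w) z * e) 0 :=
      hq.differentiableAt.hasDerivAt.comp_of_eq (0 : ℝ) (hline 0) hl0.symm
    have h2 := Complex.reCLM.hasFDerivAt.comp_hasDerivAt (0 : ℝ) (h1.const_mul e)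
    refine h2.congr_deriv ?_
    simp only [Complex.reCLM_apply]
    congr 1; ring

/-! ### Ahlfors' metric on the plane punctured at `0` and `1` -/

/-- The function `A` with `exp (A (log ‖w‖)) = (1 + ‖w‖ ^ (1 / 3)) ^ (1 / 2) / ‖w‖ ^ (5 / 6)`, a
factor of Ahlfors' negatively curved metric on `ℂ \ {0, 1}`. -/
noncomputable def ahlforsFactor (x : ℝ) : ℝ := Real.log (1 + Real.exp (x / 3)) / 2 - 5 / 6 * x

/-- The derivative of `ahlforsFactor`. -/
noncomputable def ahlforsFactor' (x : ℝ) : ℝ :=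
  Real.exp (x / 3) / (1 + Real.exp (x / 3)) / 6 - 5 / 6

/-- The second derivative of `ahlforsFactor`. -/
noncomputable def ahlforsFactor'' (x : ℝ) : ℝ :=
  Real.exp (x / 3) / (1 + Real.exp (x / 3)) ^ 2 / 18

theorem hasDerivAt_exp_div_three (x : ℝ) :
    HasDerivAt (fun x => Real.exp (x / 3)) (Real.exp (x / 3) / 3) x := by
  simpa [div_eq_mul_inv] using ((hasDerivAt_id x).div_const 3).exp

theorem hasDerivAt_ahlforsFactor (x : ℝ) :
    HasDerivAt ahlforsFactor (ahlforsFactor' x) x := by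
  have h := ((((hasDerivAt_exp_div_three x).const_add 1).log (by positivity)).div_const 2).sub
    ((hasDerivAt_id x).const_mul (5 / 6))
  refine h.congr_deriv ?_
  simp only [ahlforsFactor']; ring

theorem hasDerivAt_ahlforsFactor' (x : ℝ) :
    HasDerivAt ahlforsFactor' (ahlforsFactor'' x) x := by
  have h := (((hasDerivAt_exp_div_three x).div ((hasDerivAt_exp_div_three x).const_add 1)
    (by positivity)).div_const 6).sub_const (5 / 6)
  refine h.congr_deriv ?_
  simp only [ahlforsFactor'']
  have : (1 + Real.exp (x / 3)) ≠ 0 := by positivity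
  field_simp
  ring

theorem continuous_ahlforsFactor : Continuous ahlforsFactor :=
  continuous_iff_continuousAt.2 fun x => (hasDerivAt_ahlforsFactor x).continuousAt

theorem ahlfors_curvature_aux {s t : ℝ} (hs : 0 < s) (ht : 0 < t) (h : 1 ≤ s ^ 3 + t ^ 3) :
    (1 + s) ^ 3 * (1 + t) ^ 3 ≤ 162 * (t ^ 5 * (1 + t) ^ 2 + s ^ 5 * (1 + s) ^ 2) := by
  wlog hst : s ≤ t generalizing s t
  · have := this ht hs (by linarith) (by linarith)
    linarith
  have h2 : 1 / 2 ≤ t := by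
    by_contra! h2
    have a : t ^ 3 ≤ (1 / 2) ^ 3 := by gcongr
    have b : s ^ 3 ≤ (1 / 2) ^ 3 := by gcongr; linarith
    norm_num at a b
    linarith
  have h4 : (1 + t) ^ 4 ≤ 162 * t ^ 5 := by
    have : (1 + t) ^ 4 ≤ (3 * t) ^ 4 := by gcongr; linarith
    have h' : t ^ 4 * 1 ≤ t ^ 4 * (2 * t) := by gcongr; linarith
    nlinarith
  calc (1 + s) ^ 3 * (1 + t) ^ 3 ≤ (1 + t) ^ 3 * (1 + t) ^ 3 := by gcongr
    _ = (1 + t) ^ 4 * (1 + t) ^ 2 := by ring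
    _ ≤ 162 * t ^ 5 * (1 + t) ^ 2 := by gcongr
    _ ≤ _ := by nlinarith [show 0 ≤ s ^ 5 * (1 + s) ^ 2 by positivity]

theorem exp_log_div_three_pow {x : ℝ} (hx : 0 < x) : Real.exp (Real.log x / 3) ^ 3 = x := by
  rw [← Real.exp_nat_mul]
  convert Real.exp_log hx using 2
  push_cast; ring

theorem exp_two_mul_ahlforsFactor {x : ℝ} :
    Real.exp (ahlforsFactor x) ^ 2 =
      (1 + Real.exp (x / 3)) / Real.exp (x / 3) ^ 5 := by
  rw [← Real.exp_nat_mul, ← Real.exp_nat_mul]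
  have : (2 : ℕ) * ahlforsFactor x = Real.log (1 + Real.exp (x / 3)) - (5 : ℕ) * (x / 3) := by
    simp only [ahlforsFactor]; push_cast; ring
  rw [this, Real.exp_sub, Real.exp_log (by positivity)]

/-- The curvature of Ahlfors' metric is bounded above by a negative constant. -/
theorem ahlfors_curvature {w : ℂ} (h0 : w ≠ 0) (h1 : w ≠ 1) :
    (Real.exp (ahlforsFactor (Real.log ‖w‖)) * Real.exp (ahlforsFactor (Real.log ‖w - 1‖))) ^ 2 ≤
      2916 * (ahlforsFactor'' (Real.log ‖w‖) / ‖w‖ ^ 2 +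
        ahlforsFactor'' (Real.log ‖w - 1‖) / ‖w - 1‖ ^ 2) := by
  have hw : 0 < ‖w‖ := norm_pos_iff.2 h0
  have hw1 : 0 < ‖w - 1‖ := norm_pos_iff.2 (sub_ne_zero.2 h1)
  rw [mul_pow, exp_two_mul_ahlforsFactor, exp_two_mul_ahlforsFactor]
  simp only [ahlforsFactor'']
  have es := exp_log_div_three_pow hw
  have et := exp_log_div_three_pow hw1
  have hs : 0 < Real.exp (Real.log ‖w‖ / 3) := Real.exp_pos _
  have ht : 0 < Real.exp (Real.log ‖w - 1‖ / 3) := Real.exp_pos _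
  generalize Real.exp (Real.log ‖w‖ / 3) = s at *
  generalize Real.exp (Real.log ‖w - 1‖ / 3) = t at *
  have htri : 1 ≤ ‖w‖ + ‖w - 1‖ := by
    have := norm_sub_le w (w - 1)
    simpa using this
  rw [← es, ← et] at htri ⊢
  have key := ahlfors_curvature_aux hs ht htri
  have e1 : (1 + s) / s ^ 5 * ((1 + t) / t ^ 5) =
      ((1 + s) ^ 3 * (1 + t) ^ 3) / (s ^ 5 * t ^ 5 * (1 + s) ^ 2 * (1 + t) ^ 2) := by
    field_simp
  have e2 : 2916 * (s / (1 + s) ^ 2 / 18 / (s ^ 3) ^ 2 + t / (1 + t) ^ 2 / 18 / (t ^ 3) ^ 2) =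
      162 * (t ^ 5 * (1 + t) ^ 2 + s ^ 5 * (1 + s) ^ 2) /
        (s ^ 5 * t ^ 5 * (1 + s) ^ 2 * (1 + t) ^ 2) := by
    field_simp
    ring
  rw [e1, e2]
  gcongr

/-- Ahlfors' metric dominates the spherical metric up to a constant. -/
theorem spherical_le_ahlfors {w : ℂ} (h0 : w ≠ 0) (h1 : w ≠ 1) :
    1 ≤ 32 * (1 + ‖w‖ ^ 2) *
      (Real.exp (ahlforsFactor (Real.log ‖w‖)) * Real.exp (ahlforsFactor (Real.log ‖w - 1‖))) := by
  have hw : 0 < ‖w‖ := norm_pos_iff.2 h0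
  have hw1 : 0 < ‖w - 1‖ := norm_pos_iff.2 (sub_ne_zero.2 h1)
  rw [← one_le_sq_iff₀ (by positivity), mul_pow, mul_pow (Real.exp _),
    exp_two_mul_ahlforsFactor, exp_two_mul_ahlforsFactor]
  have es := exp_log_div_three_pow hw
  have et := exp_log_div_three_pow hw1
  have hs : 0 < Real.exp (Real.log ‖w‖ / 3) := Real.exp_pos _
  have ht : 0 < Real.exp (Real.log ‖w - 1‖ / 3) := Real.exp_pos _
  generalize Real.exp (Real.log ‖w‖ / 3) = s at *
  generalize Real.exp (Real.log ‖w - 1‖ / 3) = t at *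
  have htri : ‖w - 1‖ ≤ ‖w‖ + 1 := by simpa using norm_sub_le w 1
  rw [← es, ← et] at htri
  rw [← es]
  have hts : t ≤ 1 + s := by
    by_contra! h
    have : (1 + s) ^ 3 < t ^ 3 := by gcongr
    nlinarith [sq_nonneg s, mul_pos hs hs]
  have h6 : (1 + s) ^ 6 ≤ 32 * (1 + s ^ 6) := by
    have := add_pow_le zero_le_one hs.le 6
    norm_num at this
    exact this
  have : s ^ 5 * t ^ 5 ≤ (32 * (1 + (s ^ 3) ^ 2)) ^ 2 * ((1 + s) * (1 + t)) := by
    calc s ^ 5 * t ^ 5 ≤ (1 + s) ^ 5 * (1 + s) ^ 5 := by gcongr; linarith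
      _ = (1 + s) ^ 10 * 1 := by ring
      _ ≤ (1 + s) ^ 10 * (1 + s) ^ 2 := by gcongr; nlinarith
      _ = ((1 + s) ^ 6) ^ 2 * 1 := by ring
      _ ≤ (32 * (1 + s ^ 6)) ^ 2 * ((1 + s) * (1 + t)) := by gcongr; nlinarith
      _ = _ := by ring
  rw [div_mul_div_comm, ← mul_div_assoc, one_le_div (by positivity)]
  exact this

/-! ### Ahlfors' lemma -/

/-- Minus the logarithm of the hyperbolic density of the unit disc, up to a constant, along a line;
the second derivatives in the directions `1` and `I` add up to `-4 / (1 - ‖z‖ ^ 2) ^ 2`. -/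
theorem hasSecondDeriv_log_one_sub_norm_sq {z : ℂ} (hz : ‖z‖ < 1) (e : ℂ) :
    HasSecondDeriv (fun t : ℝ => Real.log (1 - ‖z + t * e‖ ^ 2))
      (-2 * (z.re * e.re + z.im * e.im) / (1 - ‖z‖ ^ 2))
      (-4 * (z.re * e.re + z.im * e.im) ^ 2 / (1 - ‖z‖ ^ 2) ^ 2
        - 2 * ‖e‖ ^ 2 / (1 - ‖z‖ ^ 2)) := by
  have hw : 0 < 1 - ‖z‖ ^ 2 := by nlinarith [norm_nonneg z]
  set b := z.re * e.re + z.im * e.im with hb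
  have hexp : ∀ t : ℝ, 1 - ‖z + t * e‖ ^ 2 = 1 - ‖z‖ ^ 2 - 2 * b * t - ‖e‖ ^ 2 * t ^ 2 := by
    intro t
    simp only [← Complex.normSq_eq_norm_sq, Complex.normSq_apply, Complex.add_re, Complex.add_im,
      Complex.mul_re, Complex.mul_im, Complex.ofReal_re, Complex.ofReal_im, hb]
    ring
  have hpoly : HasSecondDeriv (fun t : ℝ => 1 - ‖z + t * e‖ ^ 2) (-2 * b) (-2 * ‖e‖ ^ 2) := by
    simp only [hexp]
    refine ⟨fun t => -2 * b - 2 * ‖e‖ ^ 2 * t, .of_forall fun t => ?_, by simp, ?_⟩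
    · refine ((((hasDerivAt_id t).const_mul (2 * b)).const_sub (1 - ‖z‖ ^ 2)).sub
        (((hasDerivAt_id t).pow 2).const_mul (‖e‖ ^ 2))).congr_deriv ?_
      simp; ring
    · refine (((hasDerivAt_id (0 : ℝ)).const_mul (2 * ‖e‖ ^ 2)).const_sub (-2 * b)).congr_deriv ?_
      ring
  have e0 : 1 - ‖z + (0 : ℝ) * e‖ ^ 2 = 1 - ‖z‖ ^ 2 := by simp
  have := hpoly.comp (B := Real.log) (B' := fun x => x⁻¹) (B₂ := -((1 - ‖z‖ ^ 2) ^ 2)⁻¹)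
    (by
      rw [e0]
      filter_upwards [eventually_gt_nhds hw] with x hx using Real.hasDerivAt_log hx.ne')
    (by rw [e0]; exact hasDerivAt_inv hw.ne')
  rw [e0] at this
  convert this using 1
  · field_simp
  · field_simp
    ring

/-- **Ahlfors' lemma** for Ahlfors' metric on `ℂ \ {0, 1}`, at the centre of the unit disc. -/
theorem ahlfors_lemma {F : ℂ → ℂ}
    (hF : ∀ z ∈ Metric.closedBall (0 : ℂ) 1, AnalyticAt ℂ F z)
    (h0 : ∀ z ∈ Metric.closedBall (0 : ℂ) 1, F z ≠ 0)
    (h1 : ∀ z ∈ Metric.closedBall (0 : ℂ) 1, F z ≠ 1) :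
    ‖deriv F 0‖ * (Real.exp (ahlforsFactor (Real.log ‖F 0‖)) *
      Real.exp (ahlforsFactor (Real.log ‖F 0 - 1‖))) ≤ 108 := by
  set ρ : ℂ → ℝ := fun z => Real.exp (ahlforsFactor (Real.log ‖F z‖)) *
      Real.exp (ahlforsFactor (Real.log ‖F z - 1‖)) with hρ
  have hρpos : ∀ z, 0 < ρ z := fun z => by positivity
  have hcont : ContinuousOn (fun z => (1 - ‖z‖ ^ 2) * (‖deriv F z‖ * ρ z))
      (Metric.closedBall (0 : ℂ) 1) := by
    intro z hz
    apply ContinuousAt.continuousWithinAt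
    have c0 := (hF z hz).continuousAt
    have c1 := (hF z hz).deriv.continuousAt
    refine ContinuousAt.mul (by fun_prop) (c1.norm.mul (ContinuousAt.mul ?_ ?_))
    · exact Real.continuous_exp.continuousAt.comp (continuous_ahlforsFactor.continuousAt.comp
        (c0.norm.log (norm_ne_zero_iff.2 (h0 z hz))))
    · exact Real.continuous_exp.continuousAt.comp (continuous_ahlforsFactor.continuousAt.comp
        ((c0.sub continuousAt_const).norm.log (norm_ne_zero_iff.2 (sub_ne_zero.2 (h1 z hz)))))
  obtain ⟨z, hz, hmax⟩ := (isCompact_closedBall (0 : ℂ) 1).exists_isMaxOn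
    ⟨0, by simp⟩ hcont
  have hle := hmax (show (0 : ℂ) ∈ Metric.closedBall (0 : ℂ) 1 by simp)
  simp only [Set.mem_ofPred_eq, norm_zero] at hle
  have hle' : ‖deriv F 0‖ * ρ 0 ≤ (1 - ‖z‖ ^ 2) * (‖deriv F z‖ * ρ z) := by
    refine le_trans (le_of_eq ?_) hle; ring
  refine hle'.trans ?_
  have hz1 : ‖z‖ ≤ 1 := by simpa using hz
  by_contra! hbig
  have hpos : 0 < (1 - ‖z‖ ^ 2) * (‖deriv F z‖ * ρ z) := by linarith
  have hd : deriv F z ≠ 0 := by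
    intro h; simp [h] at hpos
  have hzlt : ‖z‖ < 1 := by
    refine lt_of_le_of_ne hz1 fun h => ?_
    simp [h] at hpos
  have hw : 0 < 1 - ‖z‖ ^ 2 := by nlinarith [norm_nonneg z]
  have hFz := hF z hz
  have hFz' : AnalyticAt ℂ (fun w => F w - 1) z := hFz.sub analyticAt_const
  have hd' : deriv (fun w => F w - 1) = deriv F := by funext w; simp
  -- At an interior maximum the second derivatives of the logarithm are nonpositive.
  have hsec : ∀ e : ℂ, _ ≤ (0 : ℝ) := fun e =>
    ((((hasSecondDeriv_log_one_sub_norm_sq hzlt e).add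
      (hasSecondDeriv_log_norm hFz.deriv hd e)).add
      ((hasSecondDeriv_log_norm hFz (h0 z hz) e).comp
        (.of_forall hasDerivAt_ahlforsFactor) (hasDerivAt_ahlforsFactor' _))).add
      ((hasSecondDeriv_log_norm hFz' (sub_ne_zero.2 (h1 z hz)) e).comp
        (.of_forall hasDerivAt_ahlforsFactor)
        (hasDerivAt_ahlforsFactor' _))).nonpos_of_isLocalMax (by
    have hline : Tendsto (fun t : ℝ => z + t * e) (𝓝 0) (𝓝 z) := by
      have : ContinuousAt (fun t : ℝ => z + t * e) 0 := by fun_prop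
      simpa using this.tendsto
    have hball : ∀ᶠ t : ℝ in 𝓝 0, z + t * e ∈ Metric.ball (0 : ℂ) 1 :=
      hline.eventually (Metric.isOpen_ball.mem_nhds (by simpa using hzlt))
    have hd0 : ∀ᶠ t : ℝ in 𝓝 0, deriv F (z + t * e) ≠ 0 :=
      hline.eventually (hFz.deriv.continuousAt.eventually_ne hd)
    have key : ∀ w ∈ Metric.ball (0 : ℂ) 1, deriv F w ≠ 0 →
        Real.log ((1 - ‖w‖ ^ 2) * (‖deriv F w‖ * ρ w)) =
        Real.log (1 - ‖w‖ ^ 2) + Real.log ‖deriv F w‖ + ahlforsFactor (Real.log ‖F w‖) +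
          ahlforsFactor (Real.log ‖F w - 1‖) := by
      intro w hw hdw
      have : ‖w‖ < 1 := by simpa using hw
      have hw' : 0 < 1 - ‖w‖ ^ 2 := by nlinarith [norm_nonneg w]
      rw [Real.log_mul hw'.ne' (by have := hρpos w; positivity),
        Real.log_mul (by positivity) (hρpos w).ne', hρ,
        Real.log_mul (by positivity) (by positivity), Real.log_exp, Real.log_exp]
      ring
    filter_upwards [hball, hd0] with t ht hdt
    have k0 := key z (by simpa using hzlt) hd
    have kt := key _ ht hdt
    simp only [Complex.ofReal_zero, zero_mul, add_zero]
    rw [← k0, ← kt]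
    have hb : ‖z + t * e‖ < 1 := by simpa using ht
    have : 0 < 1 - ‖z + t * e‖ ^ 2 := by nlinarith [norm_nonneg (z + t * e)]
    exact Real.log_le_log (by have := hρpos (z + t * e); positivity)
      (hmax (Metric.ball_subset_closedBall ht)))
  have hs := add_nonpos (hsec 1) (hsec Complex.I)
  simp only [hd', Complex.ofReal_zero, zero_mul, add_zero, one_mul, one_pow, Complex.I_sq, neg_mul,
    Complex.neg_re, Complex.one_re, Complex.one_im, Complex.I_re, Complex.I_im, mul_zero, mul_one,
    zero_add, norm_one, Complex.norm_I, Complex.I_mul_re] at hs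
  have e1 : ∀ q : ℂ, ‖q‖ ^ 2 = q.re ^ 2 + q.im ^ 2 := fun q => by
    rw [← Complex.normSq_eq_norm_sq, Complex.normSq_apply]; ring
  have hcurv := ahlfors_curvature (h0 z hz) (h1 z hz)
  have hq0 := e1 (deriv F z / F z)
  have hq1 := e1 (deriv F z / (F z - 1))
  have hzz := e1 z
  rw [norm_div] at hq0 hq1
  -- The harmonic terms cancel.
  have hs' : ahlforsFactor'' (Real.log ‖F z‖) * (‖deriv F z‖ / ‖F z‖) ^ 2 +
      ahlforsFactor'' (Real.log ‖F z - 1‖) * (‖deriv F z‖ / ‖F z - 1‖) ^ 2 ≤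
      4 / (1 - ‖z‖ ^ 2) ^ 2 := by
    have e2 : 4 / (1 - ‖z‖ ^ 2) ^ 2 = 4 * z.re ^ 2 / (1 - ‖z‖ ^ 2) ^ 2 +
        4 * z.im ^ 2 / (1 - ‖z‖ ^ 2) ^ 2 + 4 / (1 - ‖z‖ ^ 2) := by
      have : z.re ^ 2 = ‖z‖ ^ 2 - z.im ^ 2 := by linarith
      rw [this]; field_simp; ring
    rw [e2, hq0, hq1]
    refine le_of_sub_nonpos (le_of_eq_of_le ?_ hs)
    ring
  have hfin : ((1 - ‖z‖ ^ 2) * (‖deriv F z‖ * ρ z)) ^ 2 ≤ 108 ^ 2 := by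
    calc ((1 - ‖z‖ ^ 2) * (‖deriv F z‖ * ρ z)) ^ 2
        = (1 - ‖z‖ ^ 2) ^ 2 * (‖deriv F z‖ ^ 2 * ρ z ^ 2) := by ring
      _ ≤ (1 - ‖z‖ ^ 2) ^ 2 * (‖deriv F z‖ ^ 2 * (2916 *
          (ahlforsFactor'' (Real.log ‖F z‖) / ‖F z‖ ^ 2 +
          ahlforsFactor'' (Real.log ‖F z - 1‖) / ‖F z - 1‖ ^ 2))) := by gcongr
      _ = (1 - ‖z‖ ^ 2) ^ 2 * 2916 *
          (ahlforsFactor'' (Real.log ‖F z‖) * (‖deriv F z‖ / ‖F z‖) ^ 2 +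
          ahlforsFactor'' (Real.log ‖F z - 1‖) * (‖deriv F z‖ / ‖F z - 1‖) ^ 2) := by ring
      _ ≤ (1 - ‖z‖ ^ 2) ^ 2 * 2916 * (4 / (1 - ‖z‖ ^ 2) ^ 2) := by gcongr
      _ = 108 ^ 2 := by field_simp; norm_num
  exact absurd (pow_le_pow_iff_left₀ hpos.le (by norm_num) two_ne_zero |>.1 hfin) (by linarith)

/-- A holomorphic function omitting `0` and `1` has bounded spherical derivative, locally uniformly
and independently of the function. -/
theorem norm_deriv_le_of_omits {f : ℂ → ℂ} {c : ℂ} {R : ℝ} (hR : 0 < R)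
    (hf : ∀ z ∈ Metric.closedBall c R, AnalyticAt ℂ f z)
    (h0 : ∀ z ∈ Metric.closedBall c R, f z ≠ 0) (h1 : ∀ z ∈ Metric.closedBall c R, f z ≠ 1) :
    ‖deriv f c‖ ≤ 3456 / R * (1 + ‖f c‖ ^ 2) := by
  have hmem : ∀ z ∈ Metric.closedBall (0 : ℂ) 1, c + R * z ∈ Metric.closedBall c R := by
    intro z hz
    simp only [Metric.mem_closedBall, dist_zero_right] at hz
    simp only [Metric.mem_closedBall, dist_self_add_left, norm_mul, Complex.norm_real,
      Real.norm_eq_abs, abs_of_pos hR]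
    nlinarith
  have hd : deriv (fun z => f (c + R * z)) 0 = deriv f c * R := by
    have hi : HasDerivAt (fun z : ℂ => c + R * z) (R : ℂ) 0 := by
      simpa using ((hasDerivAt_id (0 : ℂ)).const_mul (R : ℂ)).const_add c
    have hfc := (hf c (Metric.mem_closedBall_self hR.le)).differentiableAt.hasDerivAt
    exact (hfc.comp_of_eq 0 hi (by simp)).deriv
  have hA := ahlfors_lemma (F := fun z => f (c + R * z))
    (fun z hz => AnalyticAt.comp (f := fun z : ℂ => c + R * z) (hf _ (hmem z hz)) (by fun_prop))
    (fun z hz => h0 _ (hmem z hz)) (fun z hz => h1 _ (hmem z hz))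
  simp only [hd, mul_zero, add_zero, norm_mul, Complex.norm_real, Real.norm_eq_abs,
    abs_of_pos hR] at hA
  have hc := Metric.mem_closedBall_self (x := c) hR.le
  have hS := spherical_le_ahlfors (h0 c hc) (h1 c hc)
  set ρ := Real.exp (ahlforsFactor (Real.log ‖f c‖)) * Real.exp (ahlforsFactor (Real.log ‖f c - 1‖))
  rw [div_mul_eq_mul_div, le_div_iff₀ hR]
  calc ‖deriv f c‖ * R = ‖deriv f c‖ * R * 1 := by ring
    _ ≤ ‖deriv f c‖ * R * (32 * (1 + ‖f c‖ ^ 2) * ρ) := by gcongr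
    _ = 32 * (1 + ‖f c‖ ^ 2) * (‖deriv f c‖ * R * ρ) := by ring
    _ ≤ 32 * (1 + ‖f c‖ ^ 2) * 108 := by gcongr
    _ = _ := by ring

/-! ### The chordal metric -/

/-- Stereographic embedding of the extended complex plane in `ℂ × ℝ`. -/
noncomputable def stereographicEmbedding (x : OnePoint ℂ) : ℂ × ℝ :=
  x.elim (0, 1) fun z => ((1 + ‖z‖ ^ 2)⁻¹ • (2 * z), 1 - 2 * (1 + ‖z‖ ^ 2)⁻¹)

theorem stereographicEmbedding_infty : stereographicEmbedding OnePoint.infty = (0, 1) := rfl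

theorem stereographicEmbedding_coe (z : ℂ) : stereographicEmbedding z =
    ((1 + ‖z‖ ^ 2)⁻¹ • (2 * z), 1 - 2 * (1 + ‖z‖ ^ 2)⁻¹) := rfl

theorem sq_norm_stereographicEmbedding_sub_infty (z : ℂ) :
    ‖(stereographicEmbedding z).1 - (stereographicEmbedding OnePoint.infty).1‖ ^ 2 +
      ((stereographicEmbedding z).2 - (stereographicEmbedding OnePoint.infty).2) ^ 2 =
      (2 / √(1 + ‖z‖ ^ 2)) ^ 2 := by
  rw [stereographicEmbedding_coe, stereographicEmbedding_infty, div_pow,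
    Real.sq_sqrt (by positivity)]
  simp only [sub_zero, norm_smul, norm_mul, Complex.norm_ofNat, Real.norm_eq_abs]
  rw [abs_of_pos (by positivity)]
  field_simp
  ring

theorem chordalDist_sq (x y : OnePoint ℂ) : chordalDist x y ^ 2 =
    ‖(stereographicEmbedding x).1 - (stereographicEmbedding y).1‖ ^ 2 +
      ((stereographicEmbedding x).2 - (stereographicEmbedding y).2) ^ 2 := by
  induction x using OnePoint.rec with
  | infty =>
    induction y using OnePoint.rec with
    | infty => simp [chordalDist, OnePoint.infty]
    | coe w =>
      rw [norm_sub_rev, ← neg_sub (stereographicEmbedding w).2, neg_sq,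
        sq_norm_stereographicEmbedding_sub_infty]
      rfl
  | coe z =>
    induction y using OnePoint.rec with
    | infty => exact (sq_norm_stereographicEmbedding_sub_infty z).symm
    | coe w =>
      have hz : 0 < 1 + ‖z‖ ^ 2 := by positivity
      have hw : 0 < 1 + ‖w‖ ^ 2 := by positivity
      have e : chordalDist z w = 2 * ‖z - w‖ / (√(1 + ‖z‖ ^ 2) * √(1 + ‖w‖ ^ 2)) := rfl
      rw [e, div_pow, mul_pow, mul_pow, Real.sq_sqrt hz.le, Real.sq_sqrt hw.le,
        stereographicEmbedding_coe, stereographicEmbedding_coe]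
      simp only [← Complex.normSq_eq_norm_sq, Complex.normSq_apply, Complex.sub_re, Complex.sub_im,
        Complex.real_smul, Complex.mul_re, Complex.mul_im, Complex.ofReal_re, Complex.ofReal_im,
        Complex.re_ofNat, Complex.im_ofNat] at hz hw ⊢
      field_simp
      ring

theorem chordalDist_nonneg (x y : OnePoint ℂ) : 0 ≤ chordalDist x y := by
  induction x using OnePoint.rec with
  | infty =>
    induction y using OnePoint.rec with
    | infty => exact le_rfl
    | coe w => show 0 ≤ 2 / √(1 + ‖w‖ ^ 2); positivity
  | coe z =>
    induction y using OnePoint.rec with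
    | infty => show 0 ≤ 2 / √(1 + ‖z‖ ^ 2); positivity
    | coe w => show 0 ≤ 2 * ‖z - w‖ / (√(1 + ‖z‖ ^ 2) * √(1 + ‖w‖ ^ 2)); positivity

theorem continuous_stereographicEmbedding : Continuous stereographicEmbedding := by
  rw [OnePoint.continuous_iff]
  constructor
  · rw [coclosedCompact_eq_cocompact, ← Metric.cobounded_eq_cocompact,
      stereographicEmbedding_infty]
    have hn : Tendsto (fun z : ℂ => ‖z‖⁻¹) (Bornology.cobounded ℂ) (𝓝 0) :=
      tendsto_inv_atTop_zero.comp tendsto_norm_cobounded_atTop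
    have h1 : Tendsto (fun z : ℂ => (1 + ‖z‖ ^ 2)⁻¹) (Bornology.cobounded ℂ) (𝓝 0) :=
      tendsto_inv_atTop_zero.comp (tendsto_atTop_add_const_left _ _
        ((tendsto_pow_atTop two_ne_zero).comp tendsto_norm_cobounded_atTop))
    refine Tendsto.prodMk_nhds ?_ ?_
    · refine squeeze_zero_norm (a := fun z => 2 * ‖z‖⁻¹) (fun z => ?_)
        (by simpa using hn.const_mul 2)
      show ‖(1 + ‖z‖ ^ 2)⁻¹ • (2 * z)‖ ≤ _
      rw [norm_smul, norm_mul, Complex.norm_ofNat, Real.norm_eq_abs, abs_of_pos (by positivity)]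
      rcases eq_or_ne z 0 with rfl | hz
      · simp
      · have : 0 < ‖z‖ := norm_pos_iff.2 hz
        field_simp
        linarith
    · simpa using (h1.const_mul 2).const_sub 1
  · have : Continuous fun z : ℂ => (1 + ‖z‖ ^ 2)⁻¹ :=
      Continuous.inv₀ (by fun_prop) fun z => by positivity
    exact (this.smul (by fun_prop)).prodMk (continuous_const.sub (continuous_const.mul this))

theorem injective_stereographicEmbedding : Function.Injective stereographicEmbedding := by
  intro x y hxy
  have h : chordalDist x y = 0 := by
    have := chordalDist_sq x y
    rw [hxy] at this
    simpa using this
  induction x using OnePoint.rec with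
  | infty =>
    induction y using OnePoint.rec with
    | infty => rfl
    | coe w =>
      have h' : 2 / √(1 + ‖w‖ ^ 2) = 0 := h
      have : 0 < 2 / √(1 + ‖w‖ ^ 2) := by positivity
      linarith
  | coe z =>
    induction y using OnePoint.rec with
    | infty =>
      have h' : 2 / √(1 + ‖z‖ ^ 2) = 0 := h
      have : 0 < 2 / √(1 + ‖z‖ ^ 2) := by positivity
      linarith
    | coe w =>
      have h' : 2 * ‖z - w‖ / (√(1 + ‖z‖ ^ 2) * √(1 + ‖w‖ ^ 2)) = 0 := h
      have hz : √(1 + ‖z‖ ^ 2) ≠ 0 := by positivity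
      have hw : √(1 + ‖w‖ ^ 2) ≠ 0 := by positivity
      have : z - w = 0 := by simpa [hz, hw] using h'
      rw [sub_eq_zero.1 this]

/-- The metric of the extended complex plane as a subset of `ℂ × ℝ` with the sup norm; it is
equivalent to the chordal distance and induces the topology of `OnePoint ℂ`. -/
noncomputable instance : MetricSpace (OnePoint ℂ) :=
  (continuous_stereographicEmbedding.isClosedEmbedding
    injective_stereographicEmbedding).isEmbedding.comapMetricSpace stereographicEmbedding

theorem dist_onePoint_eq (x y : OnePoint ℂ) :
    dist x y = dist (stereographicEmbedding x) (stereographicEmbedding y) := rfl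

theorem dist_le_chordalDist (x y : OnePoint ℂ) : dist x y ≤ chordalDist x y := by
  have h := chordalDist_sq x y
  rw [dist_onePoint_eq, Prod.dist_eq, max_le_iff, dist_eq_norm, Real.dist_eq]
  refine ⟨abs_le_of_sq_le_sq' ?_ (chordalDist_nonneg x y) |>.2,
    abs_le_of_sq_le_sq ?_ (chordalDist_nonneg x y)⟩
  · nlinarith [sq_nonneg ((stereographicEmbedding x).2 - (stereographicEmbedding y).2)]
  · nlinarith [sq_nonneg ‖(stereographicEmbedding x).1 - (stereographicEmbedding y).1‖]

theorem chordalDist_le_two_mul_dist (x y : OnePoint ℂ) : chordalDist x y ≤ 2 * dist x y := by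
  have h := chordalDist_sq x y
  have h1 : ‖(stereographicEmbedding x).1 - (stereographicEmbedding y).1‖ ≤ dist x y := by
    rw [dist_onePoint_eq, Prod.dist_eq, dist_eq_norm]; exact le_max_left _ _
  have h2 : |(stereographicEmbedding x).2 - (stereographicEmbedding y).2| ≤ dist x y := by
    rw [dist_onePoint_eq, Prod.dist_eq, Real.dist_eq]; exact le_max_right _ _
  have h3 := sq_le_sq' (by linarith [norm_nonneg ((stereographicEmbedding x).1 -
    (stereographicEmbedding y).1), dist_nonneg (x := x) (y := y)]) h1
  have h4 := sq_le_sq' (by linarith [abs_nonneg ((stereographicEmbedding x).2 -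
    (stereographicEmbedding y).2), dist_nonneg (x := x) (y := y)]) h2
  rw [sq_abs] at h4
  refine abs_le_of_sq_le_sq' ?_ (by positivity) |>.2
  nlinarith [sq_nonneg (dist x y)]

theorem dist_coe_coe_le (z w : ℂ) : dist (z : OnePoint ℂ) w ≤ 2 * dist z w := by
  refine (dist_le_chordalDist _ _).trans ?_
  show 2 * ‖z - w‖ / (√(1 + ‖z‖ ^ 2) * √(1 + ‖w‖ ^ 2)) ≤ _
  rw [dist_eq_norm]
  refine div_le_self (by positivity) (one_le_mul_of_one_le_of_one_le ?_ ?_) <;>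
    exact Real.one_le_sqrt.2 (by simp)

/-- Mean value inequality for the spherical derivative. -/
theorem dist_coe_le_of_norm_deriv_le {f : ℂ → ℂ} {c : ℂ} {R K : ℝ}
    (hf : ∀ z ∈ Metric.ball c R, AnalyticAt ℂ f z)
    (hK : ∀ z ∈ Metric.ball c R, ‖deriv f z‖ ≤ K * (1 + ‖f z‖ ^ 2)) {w : ℂ}
    (hw : w ∈ Metric.ball c R) : dist (f w : OnePoint ℂ) (f c) ≤ 6 * K * ‖w - c‖ := by
  have hline : ∀ t : ℝ, HasDerivAt (fun t : ℝ => c + t * (w - c)) (w - c) t := fun t => by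
    simpa using ((Complex.ofRealCLM.hasDerivAt (x := t)).mul_const (w - c)).const_add c
  have hmem : ∀ t ∈ Set.Icc (0 : ℝ) 1, c + t * (w - c) ∈ Metric.ball c R := by
    intro t ht
    rw [mem_ball_iff_norm] at hw ⊢
    rw [add_sub_cancel_left, norm_mul, Complex.norm_real, Real.norm_eq_abs, abs_of_nonneg ht.1]
    nlinarith [norm_nonneg (w - c), ht.2]
  set p : ℝ → ℂ := fun t => f (c + t * (w - c)) with hp
  set p' : ℝ → ℂ := fun t => deriv f (c + t * (w - c)) * (w - c) with hp'
  have hpd : ∀ t ∈ Set.Icc (0 : ℝ) 1, HasDerivAt p (p' t) t := fun t ht =>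
    (hf _ (hmem t ht)).differentiableAt.hasDerivAt.comp_of_eq t (hline t) rfl
  have hn : ∀ t ∈ Set.Icc (0 : ℝ) 1, HasDerivAt (fun t => (1 + ‖p t‖ ^ 2)⁻¹)
      (-(2 * inner ℝ (p t) (p' t)) / (1 + ‖p t‖ ^ 2) ^ 2) t := fun t ht =>
    ((hpd t ht).norm_sq.const_add 1).fun_inv (by positivity)
  have hS : ∀ t ∈ Set.Icc (0 : ℝ) 1, HasDerivAt (fun t => stereographicEmbedding (p t))
      ((1 + ‖p t‖ ^ 2)⁻¹ • (2 * p' t) +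
        (-(2 * inner ℝ (p t) (p' t)) / (1 + ‖p t‖ ^ 2) ^ 2) • (2 * p t),
        -(2 * (-(2 * inner ℝ (p t) (p' t)) / (1 + ‖p t‖ ^ 2) ^ 2))) t := fun t ht => by
    simp only [stereographicEmbedding_coe]
    exact ((hn t ht).smul ((hpd t ht).const_mul 2)).prodMk (((hn t ht).const_mul 2).const_sub 1)
  have key := norm_image_sub_le_of_norm_deriv_le_segment_01'
    (fun t ht => (hS t ht).hasDerivWithinAt) (C := 6 * K * ‖w - c‖) (fun t ht => by
      have ht' := Set.Ico_subset_Icc_self ht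
      set N := 1 + ‖p t‖ ^ 2 with hN
      have hNpos : 0 < N := by positivity
      have hb : ‖p' t‖ / N ≤ K * ‖w - c‖ := by
        rw [div_le_iff₀ hNpos, hp', norm_mul]
        calc _ ≤ (K * (1 + ‖p t‖ ^ 2)) * ‖w - c‖ := by gcongr; exact hK _ (hmem t ht')
          _ = _ := by rw [hN]; ring
      have hin := abs_real_inner_le_norm (p t) (p' t)
      have hpN : ‖p t‖ ≤ N := by nlinarith [sq_nonneg (‖p t‖ - 1)]
      have habs : |-(2 * inner ℝ (p t) (p' t)) / N ^ 2| ≤ 2 * (‖p t‖ * ‖p' t‖) / N ^ 2 := by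
        rw [abs_div, abs_neg, abs_mul, abs_two, abs_of_pos (show 0 < N ^ 2 by positivity)]
        gcongr
      rw [Prod.norm_def, max_le_iff]
      constructor
      · refine (norm_add_le _ _).trans ?_
        rw [norm_smul, norm_smul, norm_mul 2 (p' t), norm_mul 2 (p t),
          Complex.norm_ofNat, Real.norm_eq_abs, Real.norm_eq_abs, abs_of_pos (inv_pos.2 hNpos)]
        calc _ ≤ N⁻¹ * (2 * ‖p' t‖) + 2 * (‖p t‖ * ‖p' t‖) / N ^ 2 * (2 * ‖p t‖) := by gcongr
          _ = 2 * (‖p' t‖ / N) + 4 * (‖p' t‖ / N) * (‖p t‖ ^ 2 / N) := by field_simp; ring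
          _ ≤ 2 * (‖p' t‖ / N) + 4 * (‖p' t‖ / N) * 1 := by
            gcongr
            rw [div_le_one hNpos, hN]; linarith
          _ ≤ _ := by linarith
      · rw [norm_neg, Real.norm_eq_abs, abs_mul, abs_two]
        calc _ ≤ 2 * (2 * (‖p t‖ * ‖p' t‖) / N ^ 2) := by gcongr
          _ = 4 * (‖p' t‖ / N) * (‖p t‖ / N) := by field_simp; ring
          _ ≤ 4 * (‖p' t‖ / N) * 1 := by
            gcongr
            rwa [div_le_one hNpos]
          _ ≤ _ := by
            have : 0 ≤ ‖p' t‖ / N := by positivity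
            linarith)
  rw [dist_onePoint_eq, dist_eq_norm]
  simpa [hp] using key

/-! ### Möbius transformations -/

/-- The finite part of a point of the extended plane, with the junk value `0` at `∞`. -/
def finitePart (x : OnePoint ℂ) : ℂ := x.elim 0 id

@[simp] theorem finitePart_coe (z : ℂ) : finitePart z = z := rfl

@[simp] theorem finitePart_infty : finitePart OnePoint.infty = 0 := rfl

theorem coe_finitePart {x : OnePoint ℂ} (hx : x ≠ OnePoint.infty) :
    (finitePart x : OnePoint ℂ) = x := by
  obtain ⟨z, rfl⟩ := OnePoint.ne_infty_iff_exists.1 hx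
  rfl

theorem continuousAt_finitePart {x : OnePoint ℂ} (hx : x ≠ OnePoint.infty) :
    ContinuousAt finitePart x := by
  obtain ⟨z, rfl⟩ := OnePoint.ne_infty_iff_exists.1 hx
  rw [OnePoint.continuousAt_coe]
  exact continuousAt_id

/-- Inversion of the extended plane, interchanging `0` and `∞`. -/
noncomputable def sphereInv (x : OnePoint ℂ) : OnePoint ℂ :=
  open Classical in x.elim ((0 : ℂ) : OnePoint ℂ)
    fun z => if z = 0 then OnePoint.infty else ((z⁻¹ : ℂ) : OnePoint ℂ)

@[simp] theorem sphereInv_infty : sphereInv OnePoint.infty = ((0 : ℂ) : OnePoint ℂ) := rfl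

@[simp] theorem sphereInv_zero : sphereInv ((0 : ℂ) : OnePoint ℂ) = OnePoint.infty := by
  simp [sphereInv]

theorem sphereInv_coe {z : ℂ} (hz : z ≠ 0) : sphereInv z = ((z⁻¹ : ℂ) : OnePoint ℂ) := by
  simp [sphereInv, hz]

@[simp] theorem finitePart_sphereInv_coe (z : ℂ) : finitePart (sphereInv z) = z⁻¹ := by
  rcases eq_or_ne z 0 with rfl | hz
  · simp
  · simp [sphereInv_coe hz]

theorem sphereInv_involutive : Function.Involutive sphereInv := by
  intro x
  induction x using OnePoint.rec with
  | infty => simp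
  | coe z =>
    rcases eq_or_ne z 0 with rfl | hz
    · simp
    · rw [sphereInv_coe hz, sphereInv_coe (inv_ne_zero hz), inv_inv]

theorem continuous_sphereInv : Continuous sphereInv := by
  rw [continuous_iff_continuousAt]
  intro x
  induction x using OnePoint.rec with
  | infty =>
    rw [OnePoint.continuousAt_infty', coclosedCompact_eq_cocompact,
      ← Metric.cobounded_eq_cocompact]
    have h : Tendsto (fun z : ℂ => ((z⁻¹ : ℂ) : OnePoint ℂ)) (Bornology.cobounded ℂ)
        (𝓝 ((0 : ℂ) : OnePoint ℂ)) :=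
      (OnePoint.continuous_coe.tendsto 0).comp tendsto_inv₀_cobounded
    refine h.congr' ?_
    filter_upwards [Bornology.eventually_ne_cobounded (0 : ℂ)] with z hz
    exact (sphereInv_coe hz).symm
  | coe z =>
    rw [OnePoint.continuousAt_coe]
    rcases eq_or_ne z 0 with rfl | hz
    · rw [continuousAt_iff_punctured_nhds]
      have h : Tendsto (fun z : ℂ => ((z⁻¹ : ℂ) : OnePoint ℂ)) (𝓝[≠] 0) (𝓝 OnePoint.infty) := by
        refine Tendsto.comp OnePoint.tendsto_coe_infty ?_
        rw [coclosedCompact_eq_cocompact, ← Metric.cobounded_eq_cocompact]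
        exact tendsto_inv₀_nhdsNE_zero
      simp only [Function.comp, sphereInv_zero]
      refine h.congr' ?_
      filter_upwards [self_mem_nhdsWithin] with z hz using (sphereInv_coe hz).symm
    · have h : ContinuousAt (fun z : ℂ => ((z⁻¹ : ℂ) : OnePoint ℂ)) z :=
        OnePoint.continuous_coe.continuousAt.comp (continuousAt_inv₀ hz)
      refine h.congr ?_
      filter_upwards [eventually_ne_nhds hz] with z hz using (sphereInv_coe hz).symm

/-- Inversion as a homeomorphism. -/
noncomputable def sphereInvHomeomorph : OnePoint ℂ ≃ₜ OnePoint ℂ where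
  toEquiv := sphereInv_involutive.toPerm
  continuous_toFun := continuous_sphereInv
  continuous_invFun := continuous_sphereInv

@[simp] theorem sphereInvHomeomorph_apply (x : OnePoint ℂ) :
    sphereInvHomeomorph x = sphereInv x := rfl

/-- The affine map `z ↦ a * z + b`, extended to fix `∞`. -/
noncomputable def sphereAffine (a b : ℂ) (ha : a ≠ 0) : OnePoint ℂ ≃ₜ OnePoint ℂ :=
  ((Homeomorph.mulLeft₀ a ha).trans (Homeomorph.addRight b)).onePointCongr

@[simp] theorem sphereAffine_coe (a b : ℂ) (ha : a ≠ 0) (z : ℂ) :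
    sphereAffine a b ha z = ((a * z + b : ℂ) : OnePoint ℂ) := rfl

@[simp] theorem sphereAffine_infty (a b : ℂ) (ha : a ≠ 0) :
    sphereAffine a b ha OnePoint.infty = OnePoint.infty := rfl

/-! ### Holomorphic maps into the sphere -/

/-- Holomorphy of a map into the Riemann sphere: in one of the two standard charts the map is given
by an analytic function. The constant `∞` is included. -/
def SphereAnalyticAt (f : ℂ → OnePoint ℂ) (z : ℂ) : Prop :=
  ∃ h : ℂ → ℂ, AnalyticAt ℂ h z ∧
    (f =ᶠ[𝓝 z] (fun w => (h w : OnePoint ℂ)) ∨ f =ᶠ[𝓝 z] fun w => sphereInv (h w))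

theorem SphereAnalyticAt.continuousAt {f : ℂ → OnePoint ℂ} {z : ℂ} (hf : SphereAnalyticAt f z) :
    ContinuousAt f z := by
  obtain ⟨h, hh, e | e⟩ := hf
  · exact (OnePoint.continuous_coe.continuousAt.comp hh.continuousAt).congr e.symm
  · exact ((continuous_sphereInv.comp OnePoint.continuous_coe).continuousAt.comp
      hh.continuousAt).congr e.symm

theorem SphereAnalyticAt.analyticAt_finitePart {f : ℂ → OnePoint ℂ} {z : ℂ}
    (hf : SphereAnalyticAt f z) (hz : f z ≠ OnePoint.infty) :
    AnalyticAt ℂ (fun w => finitePart (f w)) z := by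
  obtain ⟨h, hh, e | e⟩ := hf
  · refine hh.congr ?_
    filter_upwards [e] with w hw
    rw [hw, finitePart_coe]
  · have h0 : h z ≠ 0 := by
      intro h0
      rw [e.eq_of_nhds, h0, sphereInv_zero] at hz
      exact hz rfl
    refine (hh.inv h0).congr ?_
    filter_upwards [e] with w hw
    rw [hw, finitePart_sphereInv_coe]
    rfl

/-- A value is taken identically near a point, or not at all near but off this point. -/
theorem SphereAnalyticAt.eventually_eq_or_eventually_ne {f : ℂ → OnePoint ℂ} {z : ℂ}
    (hf : SphereAnalyticAt f z) (a : OnePoint ℂ) :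
    (∀ᶠ w in 𝓝 z, f w = a) ∨ ∀ᶠ w in 𝓝[≠] z, f w ≠ a := by
  have aux : ∀ (h : ℂ → ℂ), AnalyticAt ℂ h z → ∀ b : OnePoint ℂ,
      (∀ᶠ w in 𝓝 z, (h w : OnePoint ℂ) = b) ∨ ∀ᶠ w in 𝓝[≠] z, (h w : OnePoint ℂ) ≠ b := by
    intro h hh b
    induction b using OnePoint.rec with
    | infty => exact Or.inr (.of_forall fun w => OnePoint.coe_ne_infty _)
    | coe b =>
      simpa only [ne_eq, OnePoint.coe_eq_coe] using
        hh.eventually_eq_or_eventually_ne analyticAt_const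
  obtain ⟨h, hh, e | e⟩ := hf
  · rcases aux h hh a with k | k
    · left; filter_upwards [e, k] with w h1 h2 using h1.trans h2
    · right; filter_upwards [e.filter_mono nhdsWithin_le_nhds, k] with w h1 h2
      rwa [h1]
  · rcases aux h hh (sphereInv a) with k | k
    · left; filter_upwards [e, k] with w h1 h2
      rw [h1, h2, sphereInv_involutive]
    · right; filter_upwards [e.filter_mono nhdsWithin_le_nhds, k] with w h1 h2 h3
      rw [h1] at h3
      exact h2 (by rw [← h3, sphereInv_involutive])

/-- Homeomorphisms of the sphere that preserve holomorphy under composition. -/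
def PreservesAnalytic (T : OnePoint ℂ ≃ₜ OnePoint ℂ) : Prop :=
  ∀ f z, SphereAnalyticAt f z → SphereAnalyticAt (fun w => T (f w)) z

theorem preservesAnalytic_refl : PreservesAnalytic (Homeomorph.refl _) := fun _ _ h => h

theorem PreservesAnalytic.trans {S T : OnePoint ℂ ≃ₜ OnePoint ℂ} (hS : PreservesAnalytic S)
    (hT : PreservesAnalytic T) : PreservesAnalytic (S.trans T) :=
  fun _ _ h => hT _ _ (hS _ _ h)

theorem preservesAnalytic_sphereInv : PreservesAnalytic sphereInvHomeomorph := by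
  rintro f z ⟨h, hh, e | e⟩
  · refine ⟨h, hh, Or.inr ?_⟩
    filter_upwards [e] with w hw
    rw [hw, sphereInvHomeomorph_apply]
  · refine ⟨h, hh, Or.inl ?_⟩
    filter_upwards [e] with w hw
    rw [hw, sphereInvHomeomorph_apply, sphereInv_involutive]

theorem preservesAnalytic_sphereAffine (a b : ℂ) (ha : a ≠ 0) :
    PreservesAnalytic (sphereAffine a b ha) := by
  rintro f z ⟨h, hh, e | e⟩
  · refine ⟨fun w => a * h w + b, (analyticAt_const.mul hh).add analyticAt_const, Or.inl ?_⟩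
    filter_upwards [e] with w hw
    rw [hw, sphereAffine_coe]
  · by_cases h0 : h z = 0
    · have hd : a + b * h z ≠ 0 := by simpa [h0]
      have han : AnalyticAt ℂ (fun w => a + b * h w) z :=
        analyticAt_const.add (analyticAt_const.mul hh)
      refine ⟨fun w => h w / (a + b * h w), hh.div han hd, Or.inr ?_⟩
      filter_upwards [e, han.continuousAt.eventually_ne hd] with w hw hne
      rw [hw]
      rcases eq_or_ne (h w) 0 with hw0 | hw0
      · simp [hw0]
      · rw [sphereInv_coe hw0, sphereInv_coe (div_ne_zero hw0 hne), sphereAffine_coe]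
        congr 1
        field_simp
    · refine ⟨fun w => a * (h w)⁻¹ + b, (analyticAt_const.mul (hh.inv h0)).add analyticAt_const,
        Or.inl ?_⟩
      filter_upwards [e, hh.continuousAt.eventually_ne h0] with w hw hne
      rw [hw, sphereInv_coe hne, sphereAffine_coe]

theorem exists_preservesAnalytic_eq_infty (c : OnePoint ℂ) :
    ∃ T, PreservesAnalytic T ∧ T c = OnePoint.infty := by
  induction c using OnePoint.rec with
  | infty => exact ⟨_, preservesAnalytic_refl, rfl⟩
  | coe c =>
    refine ⟨_, (preservesAnalytic_sphereAffine 1 (-c) one_ne_zero).trans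
      preservesAnalytic_sphereInv, ?_⟩
    simp

theorem exists_preservesAnalytic_zero_infty {b c : OnePoint ℂ} (h : b ≠ c) :
    ∃ T, PreservesAnalytic T ∧ T b = ((0 : ℂ) : OnePoint ℂ) ∧ T c = OnePoint.infty := by
  obtain ⟨T, hT, hc⟩ := exists_preservesAnalytic_eq_infty c
  have hb : T b ≠ OnePoint.infty := by rw [← hc]; exact T.injective.ne h
  obtain ⟨b', hb'⟩ := OnePoint.ne_infty_iff_exists.1 hb
  refine ⟨_, hT.trans (preservesAnalytic_sphereAffine 1 (-b') one_ne_zero), ?_, ?_⟩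
  · simp [← hb']
  · simp [hc]

theorem exists_preservesAnalytic_zero_one_infty {a b c : OnePoint ℂ} (hab : a ≠ b) (hac : a ≠ c)
    (hbc : b ≠ c) : ∃ T, PreservesAnalytic T ∧ T a = ((1 : ℂ) : OnePoint ℂ) ∧
      T b = ((0 : ℂ) : OnePoint ℂ) ∧ T c = OnePoint.infty := by
  obtain ⟨T, hT, hb, hc⟩ := exists_preservesAnalytic_zero_infty hbc
  have ha : T a ≠ OnePoint.infty := by rw [← hc]; exact T.injective.ne hac
  have ha0 : T a ≠ ((0 : ℂ) : OnePoint ℂ) := by rw [← hb]; exact T.injective.ne hab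
  obtain ⟨a', ha'⟩ := OnePoint.ne_infty_iff_exists.1 ha
  have ha'0 : a' ≠ 0 := by
    rintro rfl
    exact ha0 ha'.symm
  refine ⟨_, hT.trans (preservesAnalytic_sphereAffine a'⁻¹ 0 (inv_ne_zero ha'0)), ?_, ?_, ?_⟩
  · simp [← ha', ha'0]
  · simp [hb]
  · simp [hc]

/-! ### Continuous convergence and equicontinuity -/

/-- Continuous convergence at `z`: `s n w → f z` as `n → ∞` and `w → z`. On an open set this is
locally uniform convergence of continuous maps, phrased without a metric. -/
def ConvergesContinuouslyAt (s : ℕ → ℂ → OnePoint ℂ) (f : ℂ → OnePoint ℂ) (z : ℂ) : Prop :=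
  Tendsto (fun q : ℕ × ℂ => s q.1 q.2) (atTop ×ˢ 𝓝 z) (𝓝 (f z))

/-- Equicontinuity at `z`, up to finitely many terms for each entourage. Unlike equicontinuity it is
not affected by changing finitely many terms of the sequence. -/
def AsymptoticallyEquicontinuousAt (s : ℕ → ℂ → OnePoint ℂ) (z : ℂ) : Prop :=
  Tendsto (fun q : ℕ × ℂ => (s q.1 q.2, s q.1 z)) (atTop ×ˢ 𝓝 z) (uniformity (OnePoint ℂ))

theorem exists_closedBall_of_eventually_prod {p : ℕ → ℂ → Prop} {z : ℂ}
    (h : ∀ᶠ q : ℕ × ℂ in atTop ×ˢ 𝓝 z, p q.1 q.2) :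
    ∃ R > 0, ∀ᶠ n in atTop, ∀ w ∈ Metric.closedBall z R, p n w := by
  obtain ⟨pa, ha, pb, hb, hab⟩ := eventually_prod_iff.1 h
  obtain ⟨R, hR, hRb⟩ := Metric.nhds_basis_closedBall.eventually_iff.1 hb
  exact ⟨R, hR, ha.mono fun n hn w hw => hab hn (hRb hw)⟩

theorem eventually_prod_of_eventually {p : ℕ → ℂ → Prop} {z : ℂ} {U : Set ℂ} (hU : U ∈ 𝓝 z)
    (h : ∀ᶠ n in atTop, ∀ w ∈ U, p n w) : ∀ᶠ q : ℕ × ℂ in atTop ×ˢ 𝓝 z, p q.1 q.2 :=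
  (h.prod_mk hU).mono fun _ hq => hq.1 _ hq.2

theorem tendsto_prodMk_atTop_nhds (z : ℂ) :
    Tendsto (fun n : ℕ => (n, z)) atTop (atTop ×ˢ 𝓝 z) :=
  tendsto_id.prodMk (tendsto_const_nhds)

theorem tendsto_subseq_prod {φ : ℕ → ℕ} (hφ : StrictMono φ) (z : ℂ) :
    Tendsto (fun q : ℕ × ℂ => (φ q.1, q.2)) (atTop ×ˢ 𝓝 z) (atTop ×ˢ 𝓝 z) :=
  (hφ.tendsto_atTop.comp tendsto_fst).prodMk tendsto_snd

section

variable {s : ℕ → ℂ → OnePoint ℂ} {f : ℂ → OnePoint ℂ} {z : ℂ} {D : Set ℂ}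

theorem ConvergesContinuouslyAt.tendsto (h : ConvergesContinuouslyAt s f z) :
    Tendsto (fun n => s n z) atTop (𝓝 (f z)) :=
  Tendsto.comp h (tendsto_prodMk_atTop_nhds z)

theorem ConvergesContinuouslyAt.comp (h : ConvergesContinuouslyAt s f z)
    (T : OnePoint ℂ ≃ₜ OnePoint ℂ) :
    ConvergesContinuouslyAt (fun n w => T (s n w)) (fun w => T (f w)) z :=
  (T.continuous.tendsto _).comp h

theorem AsymptoticallyEquicontinuousAt.subseq (h : AsymptoticallyEquicontinuousAt s z) {φ : ℕ → ℕ}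
    (hφ : StrictMono φ) : AsymptoticallyEquicontinuousAt (s ∘ φ) z :=
  Tendsto.comp h (tendsto_subseq_prod hφ z)

theorem AsymptoticallyEquicontinuousAt.of_comp (T : OnePoint ℂ ≃ₜ OnePoint ℂ)
    (h : AsymptoticallyEquicontinuousAt (fun n w => T (s n w)) z) :
    AsymptoticallyEquicontinuousAt s z := by
  have := (CompactSpace.uniformContinuous_of_continuous T.symm.continuous)
  have := Tendsto.comp this h
  simpa [AsymptoticallyEquicontinuousAt, Function.comp_def] using this

theorem asymptoticallyEquicontinuousAt_of_dist_le {C R : ℝ} (hR : 0 < R)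
    (h : ∀ᶠ n in atTop, ∀ w ∈ Metric.ball z R, dist (s n w) (s n z) ≤ C * ‖w - z‖) :
    AsymptoticallyEquicontinuousAt s z := by
  rw [AsymptoticallyEquicontinuousAt, tendsto_uniformity_iff_dist_tendsto_zero]
  have h0 : Tendsto (fun q : ℕ × ℂ => C * ‖q.2 - z‖) (atTop ×ˢ 𝓝 z) (𝓝 0) := by
    have : ContinuousAt (fun w => C * ‖w - z‖) z := by fun_prop
    have h1 : Tendsto (fun w => C * ‖w - z‖) (𝓝 z) (𝓝 0) := by simpa using this.tendsto
    exact h1.comp tendsto_snd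
  refine squeeze_zero' (.of_forall fun _ => dist_nonneg) ?_ h0
  exact eventually_prod_of_eventually (Metric.ball_mem_nhds z hR) h

/-- A continuous limit is continuous. -/
theorem continuousAt_of_convergesContinuouslyAt
    (h : ∀ᶠ w in 𝓝 z, ConvergesContinuouslyAt s f w) : ContinuousAt f z := by
  rw [ContinuousAt, Metric.tendsto_nhds]
  intro ε hε
  obtain ⟨R, hR, hn⟩ := exists_closedBall_of_eventually_prod
    (p := fun n w => dist (s n w) (f z) < ε / 2)
    (Metric.tendsto_nhds.1 h.self_of_nhds (ε / 2) (half_pos hε))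
  filter_upwards [h, Metric.closedBall_mem_nhds z hR] with w hw hwR
  have hd : Tendsto (fun n => dist (s n w) (f z)) atTop (𝓝 (dist (f w) (f z))) :=
    hw.tendsto.dist tendsto_const_nhds
  have := le_of_tendsto hd (hn.mono fun n hn => (hn w hwR).le)
  linarith

/-- The neighbourhood in `ConvergesSpherically` serves all `ε` at once, hence the compact disc. -/
theorem convergesSpherically_of_convergesContinuouslyAt (hD : IsOpen D)
    (h : ∀ z ∈ D, ConvergesContinuouslyAt s f z) : ConvergesSpherically D s f := by
  intro z hz
  obtain ⟨R, hR, hRD⟩ := Metric.nhds_basis_closedBall.mem_iff.1 (hD.mem_nhds hz)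
  refine ⟨Metric.closedBall z R, Metric.closedBall_mem_nhds z hR, fun ε hε => ?_⟩
  have hloc : ∀ w ∈ Metric.closedBall z R,
      {q : ℕ × ℂ | chordalDist (s q.1 q.2) (f q.2) < ε} ∈ atTop ×ˢ 𝓝 w := by
    intro w hw
    have hfc : Tendsto (fun q : ℕ × ℂ => f q.2) (atTop ×ˢ 𝓝 w) (𝓝 (f w)) :=
      (continuousAt_of_convergesContinuouslyAt (by
        filter_upwards [hD.mem_nhds (hRD hw)] with v hv using h v hv)).tendsto.comp tendsto_snd
    have hd := Tendsto.dist (h w (hRD hw)) hfc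
    rw [dist_self] at hd
    filter_upwards [hd.eventually (gt_mem_nhds (half_pos hε))] with q hq
    exact (chordalDist_le_two_mul_dist _ _).trans_lt (by linarith)
  have := (isCompact_closedBall z R).mem_prod_nhdsSet_of_forall hloc
  obtain ⟨pa, ha, pb, hb, hab⟩ := eventually_prod_iff.1 this
  filter_upwards [ha] with n hn w hw
  exact hab hn (subset_of_mem_nhdsSet hb hw.1)

theorem ConvergesSpherically.convergesContinuouslyAt (h : ConvergesSpherically D s f)
    (hD : IsOpen D) (hs : ∀ n, ∀ z ∈ D, ContinuousAt (s n) z) (hz : z ∈ D) :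
    ConvergesContinuouslyAt s f z := by
  have hlu : TendstoLocallyUniformlyOn s f atTop D := by
    rw [Metric.tendstoLocallyUniformlyOn_iff]
    intro ε hε w hw
    obtain ⟨U, hU, hUε⟩ := h w hw
    refine ⟨U ∩ D, inter_mem (mem_nhdsWithin_of_mem_nhds hU) self_mem_nhdsWithin, ?_⟩
    filter_upwards [hUε ε hε] with n hn v hv
    rw [dist_comm]
    exact (dist_le_chordalDist _ _).trans_lt (hn v hv)
  have hfc : ContinuousAt f z :=
    (hlu.continuousOn (.of_forall fun n w hw => (hs n w hw).continuousWithinAt)).continuousAt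
      (hD.mem_nhds hz)
  have := tendstoLocallyUniformlyOn_iff_filter.1 hlu z hz
  rw [hD.nhdsWithin_eq hz] at this
  exact Metric.tendsto_nhds.2 fun ε hε => by
    filter_upwards [Metric.tendstoUniformlyOnFilter_iff.1 this (ε / 2) (half_pos hε),
      (hfc.tendsto.comp tendsto_snd).eventually (Metric.ball_mem_nhds (f z) (half_pos hε))]
      with q h1 h2
    rw [dist_comm] at h1
    have h2' : dist (f q.2) (f z) < ε / 2 := h2
    linarith [dist_triangle (s q.1 q.2) (f q.2) (f z)]

/-- **Arzelà–Ascoli** for sequences of maps into the sphere. -/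
theorem exists_subseq_convergesContinuouslyAt (s : ℕ → ℂ → OnePoint ℂ) (D : Set ℂ)
    (h : ∀ z ∈ D, AsymptoticallyEquicontinuousAt s z) :
    ∃ φ : ℕ → ℕ, StrictMono φ ∧ ∃ f, ∀ z ∈ D, ConvergesContinuouslyAt (s ∘ φ) f z := by
  obtain ⟨Q, hQc, hQd⟩ := TopologicalSpace.exists_countable_dense ℂ
  have : Countable Q := hQc.to_subtype
  obtain ⟨L, φ, hφ, hL⟩ := CompactSpace.tendsto_subseq (fun n (q : Q) => s n q)
  refine ⟨φ, hφ, ?_⟩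
  have hcauchy : ∀ z ∈ D, ∃ y, Tendsto (fun n => s (φ n) z) atTop (𝓝 y) := by
    intro z hz
    refine cauchySeq_tendsto_of_complete (Metric.cauchySeq_iff.2 fun ε hε => ?_)
    obtain ⟨R, hR, hn⟩ := exists_closedBall_of_eventually_prod
      (p := fun n w => dist (s (φ n) w) (s (φ n) z) < ε / 3)
      ((tendsto_uniformity_iff_dist_tendsto_zero.1 ((h z hz).subseq hφ)).eventually
        (gt_mem_nhds (by positivity)))
    obtain ⟨q, hq, hqQ⟩ := hQd.inter_open_nonempty _ Metric.isOpen_ball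
      ⟨z, Metric.mem_ball_self hR⟩
    have hqL : Tendsto (fun n => s (φ n) q) atTop (𝓝 (L ⟨q, hqQ⟩)) :=
      tendsto_pi_nhds.1 hL ⟨q, hqQ⟩
    obtain ⟨N, hN⟩ := Metric.cauchySeq_iff.1 hqL.cauchySeq (ε / 3) (by positivity)
    obtain ⟨M, hM⟩ := eventually_atTop.1 hn
    refine ⟨max N M, fun m hm n hn => ?_⟩
    have h1 := hM m (le_of_max_le_right hm) q (Metric.ball_subset_closedBall hq)
    have h2 := hM n (le_of_max_le_right hn) q (Metric.ball_subset_closedBall hq)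
    have h3 := hN m (le_of_max_le_left hm) n (le_of_max_le_left hn)
    rw [dist_comm] at h1
    linarith [dist_triangle4 (s (φ m) z) (s (φ m) q) (s (φ n) q) (s (φ n) z)]
  choose! f hf using hcauchy
  refine ⟨f, fun z hz => ?_⟩
  have h1 : Tendsto (fun q : ℕ × ℂ => s (φ q.1) z) (atTop ×ˢ 𝓝 z) (𝓝 (f z)) :=
    (hf z hz).comp tendsto_fst
  have h2 := tendsto_uniformity_iff_dist_tendsto_zero.1 ((h z hz).subseq hφ)
  exact tendsto_iff_of_dist h2 |>.2 h1

/-- A locally uniform limit of holomorphic maps into the sphere is holomorphic. -/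
theorem SphereAnalyticAt.of_convergesContinuouslyAt
    (hs : ∀ᶠ q : ℕ × ℂ in atTop ×ˢ 𝓝 z, SphereAnalyticAt (s q.1) q.2)
    (h : ∀ᶠ w in 𝓝 z, ConvergesContinuouslyAt s f w) : SphereAnalyticAt f z := by
  -- If `f z = ∞`, pass to the other chart.
  wlog hz : f z ≠ OnePoint.infty generalizing s f
  · have := this (s := fun n w => sphereInvHomeomorph (s n w))
      (f := fun w => sphereInvHomeomorph (f w))
      (hs.mono fun q hq => preservesAnalytic_sphereInv _ _ hq)
      (h.mono fun w hw => hw.comp _)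
      (by rw [not_not.1 hz]; exact OnePoint.coe_ne_infty 0)
    simpa [sphereInv_involutive _] using preservesAnalytic_sphereInv _ _ this
  have hopen : IsOpen ({OnePoint.infty}ᶜ : Set (OnePoint ℂ)) := isOpen_compl_singleton
  have hne : ∀ᶠ q : ℕ × ℂ in atTop ×ˢ 𝓝 z, s q.1 q.2 ≠ OnePoint.infty :=
    h.self_of_nhds.eventually (hopen.mem_nhds hz)
  have hfne : ∀ᶠ w in 𝓝 z, f w ≠ OnePoint.infty :=
    (continuousAt_of_convergesContinuouslyAt h).eventually (hopen.mem_nhds hz)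
  obtain ⟨R₁, hR₁, h1⟩ := exists_closedBall_of_eventually_prod
    (p := fun n w => SphereAnalyticAt (s n) w ∧ s n w ≠ OnePoint.infty) (hs.and hne)
  obtain ⟨R₂, hR₂, h2⟩ := Metric.eventually_nhds_iff_ball.1 (hfne.and h)
  set R := min R₁ R₂ with hRdef
  have hR : 0 < R := lt_min hR₁ hR₂
  have hlu : TendstoLocallyUniformlyOn (fun n w => finitePart (s n w)) (fun w => finitePart (f w))
      atTop (Metric.ball z R) := by
    rw [tendstoLocallyUniformlyOn_iff_filter]
    intro w hw
    rw [Metric.isOpen_ball.nhdsWithin_eq hw]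
    have hw2 : w ∈ Metric.ball z R₂ := Metric.ball_subset_ball (min_le_right _ _) hw
    have hcont : ContinuousAt f w := continuousAt_of_convergesContinuouslyAt (by
      filter_upwards [Metric.isOpen_ball.mem_nhds hw2] with v hv using (h2 v hv).2)
    have hfin := continuousAt_finitePart (h2 w hw2).1
    have a : Tendsto (fun q : ℕ × ℂ => finitePart (s q.1 q.2)) (atTop ×ˢ 𝓝 w)
      (𝓝 (finitePart (f w))) := hfin.tendsto.comp (h2 w hw2).2
    have b : Tendsto (fun q : ℕ × ℂ => finitePart (f q.2)) (atTop ×ˢ 𝓝 w)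
      (𝓝 (finitePart (f w))) := (hfin.tendsto.comp hcont.tendsto).comp tendsto_snd
    have := b.dist a
    rw [dist_self] at this
    exact Metric.tendstoUniformlyOnFilter_iff.2 fun ε hε => this.eventually (gt_mem_nhds hε)
  have hdiff := hlu.differentiableOn (h1.mono fun n hn w hw =>
    have hw1 := hn w (Metric.ball_subset_closedBall (Metric.ball_subset_ball (min_le_left _ _) hw))
    (hw1.1.analyticAt_finitePart hw1.2).differentiableAt.differentiableWithinAt) Metric.isOpen_ball
  refine ⟨_, hdiff.analyticAt (Metric.ball_mem_nhds z hR), Or.inl ?_⟩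
  filter_upwards [hfne] with w hw using (coe_finitePart hw).symm

end

/-! ### Meromorphic functions as holomorphic maps into the sphere -/

/-- Removable singularity of a meromorphic function with a finite limit. -/
theorem AnalyticAt.of_meromorphicAt_of_tendsto {h : ℂ → ℂ} {z c : ℂ} (hh : MeromorphicAt h z)
    (hc : Tendsto h (𝓝[≠] z) (𝓝 c)) : AnalyticAt ℂ (Function.update h z c) z := by
  refine Complex.analyticAt_of_differentiable_on_punctured_nhds_of_continuousAt ?_
    (continuousAt_update_same.2 hc)
  filter_upwards [hh.eventually_analyticAt, self_mem_nhdsWithin] with w hw hne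
  refine (hw.congr ?_).differentiableAt
  filter_upwards [isOpen_ne.mem_nhds hne] with v hv
  rw [Function.update_of_ne hv]

theorem eventually_nhds_of_eventually_nhdsNE {p : ℂ → Prop} {z : ℂ} (h : ∀ᶠ w in 𝓝[≠] z, p w)
    (hz : p z) : ∀ᶠ w in 𝓝 z, p w := by
  filter_upwards [eventually_nhdsWithin_iff.1 h] with w hw
  rcases eq_or_ne w z with rfl | hne
  · exact hz
  · exact hw hne

theorem sphereAnalyticAt_of_mem_meromorphicFunctions {D : Set ℂ} (hD : IsOpen D)
    {f : ℂ → OnePoint ℂ} (hf : f ∈ meromorphicFunctions D) {z : ℂ} (hz : z ∈ D) :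
    SphereAnalyticAt f z := by
  obtain ⟨h, hh, hlim⟩ := hf
  -- Off the exceptional point the function `h` is analytic, so its limit there is its value.
  have hval : ∀ᶠ w in 𝓝[≠] z, f w = h w := by
    filter_upwards [(hh z hz).eventually_analyticAt,
      mem_nhdsWithin_of_mem_nhds (hD.mem_nhds hz)] with w hw hwD
    exact tendsto_nhds_unique (hlim w hwD) ((OnePoint.continuous_coe.tendsto _).comp
      (hw.continuousAt.tendsto.mono_left nhdsWithin_le_nhds))
  by_cases hinf : f z = OnePoint.infty
  · have hc : Tendsto (fun w => (h w)⁻¹) (𝓝[≠] z) (𝓝 0) := by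
      have := ((continuousAt_finitePart (x := sphereInv OnePoint.infty) (by simp)).tendsto.comp
        (continuous_sphereInv.tendsto _)).comp (hinf ▸ hlim z hz)
      simpa [Function.comp_def] using this
    have hne : ∀ᶠ w in 𝓝[≠] z, h w ≠ 0 := by
      have h0 : ∀ᶠ x in 𝓝 (f z), x ≠ ((0 : ℂ) : OnePoint ℂ) := by
        rw [hinf]; exact isOpen_ne.mem_nhds (OnePoint.infty_ne_coe 0)
      filter_upwards [(hlim z hz).eventually h0] with w hw h0 using hw (by rw [h0])
    refine ⟨_, AnalyticAt.of_meromorphicAt_of_tendsto (hh z hz).inv hc, Or.inr ?_⟩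
    have hev : ∀ᶠ w in 𝓝[≠] z, f w = sphereInv (Function.update h⁻¹ z 0 w) := by
      filter_upwards [hval, hne, self_mem_nhdsWithin] with w h1 h2 h3
      rw [h1, Function.update_of_ne h3, Pi.inv_apply, sphereInv_coe (inv_ne_zero h2), inv_inv]
    exact eventually_nhds_of_eventually_nhdsNE hev (by simp [hinf])
  · have hc : Tendsto h (𝓝[≠] z) (𝓝 (finitePart (f z))) := by
      simpa [Function.comp_def] using (continuousAt_finitePart hinf).tendsto.comp (hlim z hz)
    refine ⟨_, AnalyticAt.of_meromorphicAt_of_tendsto (hh z hz) hc, Or.inl ?_⟩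
    have hev : ∀ᶠ w in 𝓝[≠] z, f w = (Function.update h z (finitePart (f z)) w : ℂ) := by
      filter_upwards [hval, self_mem_nhdsWithin] with w h1 h3
      rw [h1, Function.update_of_ne h3]
    exact eventually_nhds_of_eventually_nhdsNE hev (by simp [coe_finitePart hinf])

/-! ### Normality criteria -/

/-- **Montel's theorem**: holomorphic maps into the sphere omitting three values are
equicontinuous. -/
theorem asymptoticallyEquicontinuousAt_of_omits_three {s : ℕ → ℂ → OnePoint ℂ} {z : ℂ}
    (hs : ∀ᶠ q : ℕ × ℂ in atTop ×ˢ 𝓝 z, SphereAnalyticAt (s q.1) q.2)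
    {a : Fin 3 → OnePoint ℂ} (ha : Function.Injective a)
    (hne : ∀ j, ∀ᶠ q : ℕ × ℂ in atTop ×ˢ 𝓝 z, s q.1 q.2 ≠ a j) :
    AsymptoticallyEquicontinuousAt s z := by
  obtain ⟨T, hT, h0, h1, h2⟩ := exists_preservesAnalytic_zero_one_infty
    (ha.ne (show (0 : Fin 3) ≠ 1 by decide)) (ha.ne (show (0 : Fin 3) ≠ 2 by decide))
    (ha.ne (show (1 : Fin 3) ≠ 2 by decide))
  refine AsymptoticallyEquicontinuousAt.of_comp T ?_
  obtain ⟨R, hR, hn⟩ := exists_closedBall_of_eventually_prod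
    (p := fun n w => SphereAnalyticAt (fun w => T (s n w)) w ∧
      T (s n w) ≠ ((1 : ℂ) : OnePoint ℂ) ∧ T (s n w) ≠ ((0 : ℂ) : OnePoint ℂ) ∧
      T (s n w) ≠ OnePoint.infty) (by
    filter_upwards [hs, hne 0, hne 1, hne 2] with q k k0 k1 k2
    rw [← h0, ← h1, ← h2]
    exact ⟨hT _ _ k, T.injective.ne k0, T.injective.ne k1, T.injective.ne k2⟩)
  refine asymptoticallyEquicontinuousAt_of_dist_le (C := 6 * (3456 / (R / 2))) (half_pos hR) ?_
  filter_upwards [hn] with n hn w hw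
  have hsub : ∀ v ∈ Metric.ball z (R / 2), Metric.closedBall v (R / 2) ⊆ Metric.closedBall z R :=
    fun v hv => Metric.closedBall_subset_closedBall' (by
      have : dist v z < R / 2 := hv
      linarith)
  have han : ∀ v ∈ Metric.closedBall z R, AnalyticAt ℂ (fun w => finitePart (T (s n w))) v :=
    fun v hv => (hn v hv).1.analyticAt_finitePart (hn v hv).2.2.2
  have hcoe : ∀ v ∈ Metric.closedBall z R, (finitePart (T (s n v)) : OnePoint ℂ) = T (s n v) :=
    fun v hv => coe_finitePart (hn v hv).2.2.2
  have hball : Metric.ball z (R / 2) ⊆ Metric.closedBall z R :=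
    (Metric.ball_subset_ball (by linarith)).trans Metric.ball_subset_closedBall
  have key := dist_coe_le_of_norm_deriv_le (fun v hv => han v (hball hv))
    (fun v hv => norm_deriv_le_of_omits (half_pos hR) (fun u hu => han u (hsub v hv hu))
      (fun u hu h => (hn u (hsub v hv hu)).2.2.1 (by rw [← hcoe u (hsub v hv hu), h]))
      (fun u hu h => (hn u (hsub v hv hu)).2.1 (by rw [← hcoe u (hsub v hv hu), h]))) hw
  rwa [hcoe w (hball hw), hcoe z (Metric.mem_closedBall_self hR.le)] at key

section

variable {s : ℕ → ℂ → OnePoint ℂ} {f : ℂ → OnePoint ℂ} {z : ℂ}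

/-- Maximum principle: a sequence of pole-free maps whose limit on a circle is finite is eventually
uniformly bounded on the disc. -/
theorem exists_norm_finitePart_le {r : ℝ} (hr : 0 < r)
    (hs : ∀ᶠ n in atTop, ∀ w ∈ Metric.closedBall z r,
      SphereAnalyticAt (s n) w ∧ s n w ≠ OnePoint.infty)
    (hconv : ∀ w ∈ Metric.sphere z r, ∀ᶠ v in 𝓝 w, ConvergesContinuouslyAt s f v)
    (hf : ∀ w ∈ Metric.sphere z r, f w ≠ OnePoint.infty) :
    ∃ M, ∀ᶠ n in atTop, ∀ w ∈ Metric.closedBall z r, ‖finitePart (s n w)‖ ≤ M := by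
  obtain ⟨C, hC⟩ := (isCompact_sphere z r).exists_bound_of_continuousOn
    (f := fun w => finitePart (f w)) fun w hw =>
      (ContinuousAt.comp (continuousAt_finitePart (hf w hw))
        (continuousAt_of_convergesContinuouslyAt (hconv w hw))).continuousWithinAt
  have hloc : ∀ w ∈ Metric.sphere z r,
      {q : ℕ × ℂ | ‖finitePart (s q.1 q.2)‖ < C + 1} ∈ atTop ×ˢ 𝓝 w := by
    intro w hw
    have : Tendsto (fun q : ℕ × ℂ => ‖finitePart (s q.1 q.2)‖) (atTop ×ˢ 𝓝 w)
        (𝓝 ‖finitePart (f w)‖) :=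
      ((continuousAt_finitePart (hf w hw)).tendsto.comp (hconv w hw).self_of_nhds).norm
    exact this.eventually (gt_mem_nhds (by linarith [hC w hw]))
  obtain ⟨pa, ha, pb, hb, hab⟩ := eventually_prod_iff.1
    ((isCompact_sphere z r).mem_prod_nhdsSet_of_forall hloc)
  refine ⟨C + 1, ?_⟩
  filter_upwards [hs, ha] with n hn hna w hw
  have hd : DifferentiableOn ℂ (fun w => finitePart (s n w)) (Metric.closedBall z r) := fun v hv =>
    ((hn v hv).1.analyticAt_finitePart (hn v hv).2).differentiableAt.differentiableWithinAt
  refine Complex.norm_le_of_forall_mem_frontier_norm_le (f := fun w => finitePart (s n w))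
    Metric.isBounded_ball (hd.diffContOnCl_ball subset_rfl) (fun v hv => ?_)
    (by rwa [closure_ball z hr.ne'])
  rw [frontier_ball z hr.ne'] at hv
  exact (hab hna (subset_of_mem_nhdsSet hb hv)).le

/-- **Montel's theorem** for bounded functions. -/
theorem asymptoticallyEquicontinuousAt_of_norm_le {r M : ℝ} (hr : 0 < r)
    (hs : ∀ᶠ n in atTop, ∀ w ∈ Metric.closedBall z r,
      SphereAnalyticAt (s n) w ∧ s n w ≠ OnePoint.infty)
    (hM : ∀ᶠ n in atTop, ∀ w ∈ Metric.closedBall z r, ‖finitePart (s n w)‖ ≤ M) :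
    AsymptoticallyEquicontinuousAt s z := by
  refine asymptoticallyEquicontinuousAt_of_dist_le (C := 2 * (2 * M / r)) hr ?_
  filter_upwards [hs, hM] with n hn hM w hw
  have hsub := Metric.ball_subset_closedBall (x := z) (ε := r)
  have hzm := Metric.mem_closedBall_self (x := z) hr.le
  have hd : DifferentiableOn ℂ (fun w => finitePart (s n w)) (Metric.ball z r) := fun v hv =>
    ((hn v (hsub hv)).1.analyticAt_finitePart
      (hn v (hsub hv)).2).differentiableAt.differentiableWithinAt
  have key := Complex.dist_le_div_mul_dist_of_mapsTo_ball (R₂ := 2 * M) hd (fun v hv => by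
    have h1 := hM v (hsub hv)
    have h2 := hM z hzm
    rw [mem_closedBall_iff_norm]
    exact (norm_sub_le _ _).trans (by linarith)) hw
  have := dist_coe_coe_le (finitePart (s n w)) (finitePart (s n z))
  rw [coe_finitePart (hn w (hsub hw)).2, coe_finitePart (hn z hzm).2] at this
  refine this.trans ?_
  rw [← dist_eq_norm]
  linarith

/-- **Hurwitz's theorem**: a limit of pole-free maps has no poles, or it is `∞` in a
neighbourhood of each of its poles. -/
theorem eventually_eq_infty_of_convergesContinuouslyAt
    (hs : ∀ᶠ q : ℕ × ℂ in atTop ×ˢ 𝓝 z, SphereAnalyticAt (s q.1) q.2 ∧ s q.1 q.2 ≠ OnePoint.infty)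
    (hconv : ∀ᶠ w in 𝓝 z, ConvergesContinuouslyAt s f w) (hz : f z = OnePoint.infty) :
    ∀ᶠ w in 𝓝 z, f w = OnePoint.infty := by
  have hf : SphereAnalyticAt f z :=
    SphereAnalyticAt.of_convergesContinuouslyAt (hs.mono fun q hq => hq.1) hconv
  refine (hf.eventually_eq_or_eventually_ne OnePoint.infty).resolve_right fun hne => ?_
  obtain ⟨R₁, hR₁, h1⟩ := exists_closedBall_of_eventually_prod
    (p := fun n w => SphereAnalyticAt (s n) w ∧ s n w ≠ OnePoint.infty) hs
  obtain ⟨R₂, hR₂, h2⟩ := Metric.eventually_nhds_iff_ball.1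
    ((eventually_nhdsWithin_iff.1 hne).and hconv.eventually_nhds)
  obtain ⟨r, hr, hrR⟩ := exists_between (lt_min hR₁ hR₂)
  have hsph : ∀ w ∈ Metric.sphere z r, w ∈ Metric.ball z R₂ := fun w hw => by
    have : dist w z = r := hw
    rw [Metric.mem_ball, this]
    exact hrR.trans_le (min_le_right _ _)
  obtain ⟨M, hM⟩ := exists_norm_finitePart_le hr
    (h1.mono fun n hn w hw => hn w (Metric.closedBall_subset_closedBall
      (hrR.le.trans (min_le_left _ _)) hw))
    (fun w hw => (h2 w (hsph w hw)).2)
    (fun w hw => (h2 w (hsph w hw)).1 (Metric.ne_of_mem_sphere hw hr.ne'))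
  -- On the other hand the values at the centre tend to infinity.
  have hcl : IsClosed ((fun x : ℂ => (x : OnePoint ℂ)) '' Metric.closedBall 0 M) :=
    ((isCompact_closedBall 0 M).image OnePoint.continuous_coe).isClosed
  have hmem := hcl.mem_of_tendsto hconv.self_of_nhds.tendsto (by
    filter_upwards [hM, h1] with n hn h1
    exact ⟨finitePart (s n z), by simpa using hn z (Metric.mem_closedBall_self hr.le),
      coe_finitePart (h1 z (Metric.mem_closedBall_self hR₁.le)).2⟩)
  obtain ⟨x, -, hx⟩ := hmem
  rw [hz] at hx
  exact OnePoint.coe_ne_infty x hx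

/-- Maps omitting two values near a point are equicontinuous there if they converge in a punctured
neighbourhood. -/
theorem asymptoticallyEquicontinuousAt_of_omits_two {b c : OnePoint ℂ} (hbc : b ≠ c)
    (hs : ∀ᶠ q : ℕ × ℂ in atTop ×ˢ 𝓝 z, SphereAnalyticAt (s q.1) q.2)
    (hb : ∀ᶠ q : ℕ × ℂ in atTop ×ˢ 𝓝 z, s q.1 q.2 ≠ b)
    (hc : ∀ᶠ q : ℕ × ℂ in atTop ×ˢ 𝓝 z, s q.1 q.2 ≠ c)
    (hconv : ∀ᶠ w in 𝓝[≠] z, ConvergesContinuouslyAt s f w) :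
    AsymptoticallyEquicontinuousAt s z := by
  wlog hnorm : b = ((0 : ℂ) : OnePoint ℂ) ∧ c = OnePoint.infty generalizing s f b c
  · obtain ⟨T, hT, h0, h1⟩ := exists_preservesAnalytic_zero_infty hbc
    refine AsymptoticallyEquicontinuousAt.of_comp T ?_
    exact this (T.injective.ne hbc) (hs.mono fun q hq => hT _ _ hq)
      (hb.mono fun q hq => T.injective.ne hq) (hc.mono fun q hq => T.injective.ne hq)
      (hconv.mono fun w hw => hw.comp T) ⟨h0, h1⟩
  obtain ⟨rfl, rfl⟩ := hnorm
  obtain ⟨R₁, hR₁, h1⟩ := exists_closedBall_of_eventually_prod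
    (p := fun n w => SphereAnalyticAt (s n) w ∧ s n w ≠ ((0 : ℂ) : OnePoint ℂ) ∧
      s n w ≠ OnePoint.infty) (hs.and (hb.and hc))
  obtain ⟨R₂, hR₂, h2⟩ := Metric.eventually_nhds_iff_ball.1
    (eventually_nhdsWithin_iff.1 (eventually_nhdsNE_eventually_nhds_iff.2 hconv))
  obtain ⟨r, hr, hrR⟩ := exists_between (lt_min hR₁ hR₂)
  have hr1 : r < R₁ := hrR.trans_le (min_le_left _ _)
  have hr2 : r < R₂ := hrR.trans_le (min_le_right _ _)
  have hcv : ∀ w ∈ Metric.sphere z r, ∀ᶠ v in 𝓝 w, ConvergesContinuouslyAt s f v := fun w hw =>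
    h2 w (Metric.sphere_subset_closedBall.trans (Metric.closedBall_subset_ball hr2) hw)
      (Metric.ne_of_mem_sphere hw hr.ne')
  have hball : ∀ᶠ n in atTop, ∀ w ∈ Metric.closedBall z r, SphereAnalyticAt (s n) w ∧
      s n w ≠ ((0 : ℂ) : OnePoint ℂ) ∧ s n w ≠ OnePoint.infty :=
    h1.mono fun n hn w hw => hn w (Metric.closedBall_subset_closedBall hr1.le hw)
  -- By Hurwitz's theorem and connectedness, the limit on the circle is finite or identically `∞`.
  have hdich : (∀ w ∈ Metric.sphere z r, f w = OnePoint.infty) ∨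
      ∀ w ∈ Metric.sphere z r, f w ≠ OnePoint.infty := by
    have hpre : IsPreconnected (Metric.sphere z r) :=
      isPreconnected_sphere (by rw [Complex.rank_real_complex]; norm_num) z r
    have hcover : Metric.sphere z r ⊆ {w | ∀ᶠ v in 𝓝 w, f v = OnePoint.infty} ∪
        {w | ∀ᶠ v in 𝓝 w, f v ≠ OnePoint.infty} := by
      intro w hw
      by_cases hfw : f w = OnePoint.infty
      · refine Or.inl (eventually_eq_infty_of_convergesContinuouslyAt ?_ (hcv w hw) hfw)
        refine eventually_prod_of_eventually
          (p := fun n w => SphereAnalyticAt (s n) w ∧ s n w ≠ OnePoint.infty)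
          (U := Metric.closedBall z R₁) ?_ (h1.mono fun n hn v hv => ⟨(hn v hv).1, (hn v hv).2.2⟩)
        have hw' : dist w z = r := hw
        exact mem_of_superset (Metric.isOpen_ball.mem_nhds (by
          rwa [Metric.mem_ball, hw'])) Metric.ball_subset_closedBall
      · exact Or.inr ((continuousAt_of_convergesContinuouslyAt (hcv w hw)).eventually
          (isOpen_ne.mem_nhds hfw))
    refine (isPreconnected_iff_subset_of_disjoint.1 hpre _ _ isOpen_setOfPred_eventually_nhds
      isOpen_setOfPred_eventually_nhds hcover ?_).imp
      (fun h w hw => (h hw).self_of_nhds) (fun h w hw => (h hw).self_of_nhds)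
    ext w
    simp only [Set.mem_inter_iff, Set.mem_empty_iff_false, iff_false, not_and]
    exact fun _ h h' => h'.self_of_nhds h.self_of_nhds
  rcases hdich with hinf | hfin
  · -- The inverted maps converge to `0` on the circle; they have no poles as `s n` omits `0`.
    refine AsymptoticallyEquicontinuousAt.of_comp sphereInvHomeomorph ?_
    have hs' : ∀ᶠ n in atTop, ∀ w ∈ Metric.closedBall z r,
        SphereAnalyticAt (fun w => sphereInvHomeomorph (s n w)) w ∧
          sphereInvHomeomorph (s n w) ≠ OnePoint.infty := hball.mono fun n hn w hw =>
      ⟨preservesAnalytic_sphereInv _ _ (hn w hw).1, fun h => (hn w hw).2.1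
        (sphereInvHomeomorph.injective (by rw [h]; simp))⟩
    obtain ⟨M, hM⟩ := exists_norm_finitePart_le hr hs'
      (fun w hw => (hcv w hw).mono fun v hv => hv.comp sphereInvHomeomorph)
      (fun w hw => by simp [hinf w hw])
    exact asymptoticallyEquicontinuousAt_of_norm_le hr hs' hM
  · have hs' := hball.mono fun n hn w hw => (⟨(hn w hw).1, (hn w hw).2.2⟩ :
      SphereAnalyticAt (s n) w ∧ s n w ≠ OnePoint.infty)
    obtain ⟨M, hM⟩ := exists_norm_finitePart_le hr hs' hcv hfin
    exact asymptoticallyEquicontinuousAt_of_norm_le hr hs' hM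

end

/-! ### Isolated values and the normality of the family -/

/-- The `a`-points of a nonconstant holomorphic map on a connected open set are isolated. -/
theorem eventually_ne_of_not_const {D : Set ℂ} (hD : IsPreconnected D) {f : ℂ → OnePoint ℂ}
    (hf : ∀ z ∈ D, SphereAnalyticAt f z) {a : OnePoint ℂ} (ha : ¬ ∀ z ∈ D, f z = a) {z : ℂ}
    (hz : z ∈ D) : ∀ᶠ w in 𝓝[≠] z, f w ≠ a := by
  refine ((isPreconnected_iff_subset_of_disjoint.1 hD {w | ∀ᶠ v in 𝓝 w, f v = a}
    {w | ∀ᶠ v in 𝓝[≠] w, f v ≠ a} isOpen_setOfPred_eventually_nhds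
    isOpen_setOfPred_eventually_nhdsWithin
    (fun w hw => (hf w hw).eventually_eq_or_eventually_ne a) ?_).resolve_left
    fun h => ha fun w hw => (h hw).self_of_nhds) hz
  ext w
  simp only [Set.mem_inter_iff, Set.mem_empty_iff_false, iff_false, not_and]
  intro _ h h'
  obtain ⟨v, h1, h2⟩ := ((h.filter_mono nhdsWithin_le_nhds).and h').exists
  exact h2 h1

theorem theorem1p1 (D : Set ℂ) (hDo : IsOpen D) (hDc : IsConnected D)
    (F G : Set (ℂ → OnePoint ℂ))
    (hF : F ⊆ meromorphicFunctions D) (hG : G ⊆ meromorphicFunctions D)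
    (a : Fin 3 → OnePoint ℂ) (ha : Function.Injective a)
    (hGn : IsNormalFamily D G)
    (hGl : ∀ g, IsLimitFunction D G g → ¬ ∃ c : OnePoint ℂ, ∀ z ∈ D, g z = c)
    (hshare : ∀ f ∈ F, ∃ g ∈ G, ∀ j, SharePartially D f g (a j)) :
    IsNormalFamily D F := by
  intro s hs
  choose t htG hst using fun n => hshare (s n) (hs n)
  obtain ⟨φ, hφ, g, hg⟩ := hGn t htG
  have hgconst := hGl g ⟨t ∘ φ, fun n => htG _, hg⟩
  have htan : ∀ n, ∀ z ∈ D, SphereAnalyticAt ((t ∘ φ) n) z := fun n z hz =>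
    sphereAnalyticAt_of_mem_meromorphicFunctions hDo (hG (htG _)) hz
  have hsan : ∀ n, ∀ z ∈ D, SphereAnalyticAt (s n) z := fun n z hz =>
    sphereAnalyticAt_of_mem_meromorphicFunctions hDo (hF (hs _)) hz
  have hgc : ∀ z ∈ D, ConvergesContinuouslyAt (t ∘ φ) g z := fun z hz =>
    hg.convergesContinuouslyAt hDo (fun n w hw => (htan n w hw).continuousAt) hz
  have hprod : ∀ (u : ℕ → ℂ → OnePoint ℂ), (∀ n, ∀ z ∈ D, SphereAnalyticAt (u n) z) → ∀ z ∈ D,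
      ∀ᶠ q : ℕ × ℂ in atTop ×ˢ 𝓝 z, SphereAnalyticAt (u q.1) q.2 := fun u hu z hz =>
    eventually_prod_of_eventually (p := fun n w => SphereAnalyticAt (u n) w) (hDo.mem_nhds hz)
      (.of_forall hu)
  have hgan : ∀ z ∈ D, SphereAnalyticAt g z := fun z hz =>
    .of_convergesContinuouslyAt (hprod _ htan z hz) (by
      filter_upwards [hDo.mem_nhds hz] with w hw using hgc w hw)
  -- Near a point where the limit `g` avoids `a j`, the maps `s (φ n)` omit `a j`.
  have homit : ∀ z ∈ D, ∀ j, g z ≠ a j →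
      ∀ᶠ q : ℕ × ℂ in atTop ×ˢ 𝓝 z, s (φ q.1) q.2 ≠ a j := by
    intro z hz j hj
    filter_upwards [Tendsto.eventually (hgc z hz) (isOpen_ne.mem_nhds hj),
      tendsto_snd.eventually (hDo.mem_nhds hz)] with q hq hqD heq
    exact hq (hst (φ q.1) j ⟨hqD, heq⟩).2
  -- Montel's theorem gives convergence off the set where `g` takes one of the three values.
  obtain ⟨ψ, hψ, f, hf⟩ := exists_subseq_convergesContinuouslyAt (s ∘ φ)
    {z ∈ D | ∀ j, g z ≠ a j} fun z hz => asymptoticallyEquicontinuousAt_of_omits_three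
      (hprod _ (fun n => hsan _) z hz.1) ha fun j => homit z hz.1 j (hz.2 j)
  have hiso : ∀ z ∈ D, ∀ᶠ w in 𝓝[≠] z, ConvergesContinuouslyAt ((s ∘ φ) ∘ ψ) f w := by
    intro z hz
    have h1 : ∀ᶠ w in 𝓝[≠] z, ∀ j, g w ≠ a j := eventually_all.2 fun j =>
      eventually_ne_of_not_const hDc.isPreconnected hgan (fun h => hgconst ⟨_, h⟩) hz
    filter_upwards [h1, mem_nhdsWithin_of_mem_nhds (hDo.mem_nhds hz)] with w hw hwD
    exact hf w ⟨hwD, hw⟩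
  obtain ⟨χ, hχ, k, hk⟩ := exists_subseq_convergesContinuouslyAt ((s ∘ φ) ∘ ψ) D fun z hz => by
    -- At most one of the three values is taken by `g` at `z`.
    obtain ⟨i, j, hij, hi, hj⟩ : ∃ i j, i ≠ j ∧ g z ≠ a i ∧ g z ≠ a j := by
      by_cases h0 : g z = a 0
      · exact ⟨1, 2, by decide, by rw [h0]; exact ha.ne (by decide),
          by rw [h0]; exact ha.ne (by decide)⟩
      · by_cases h1 : g z = a 1
        · exact ⟨0, 2, by decide, h0, by rw [h1]; exact ha.ne (by decide)⟩
        · exact ⟨0, 1, by decide, h0, h1⟩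
    exact asymptoticallyEquicontinuousAt_of_omits_two (ha.ne hij)
      (hprod ((s ∘ φ) ∘ ψ) (fun n => hsan _) z hz)
      ((tendsto_subseq_prod hψ z).eventually (homit z hz i hi))
      ((tendsto_subseq_prod hψ z).eventually (homit z hz j hj)) (hiso z hz)
  exact ⟨φ ∘ ψ ∘ χ, hφ.comp (hψ.comp hχ), k,
    convergesSpherically_of_convergesContinuouslyAt hDo hk⟩
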